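/- Let $R$ be a real closed field and $C=R[i]$, $i^2=-1$. Embed $C[Z]$ in $C[X,Y]$ by $Z=X+iY$, write $F=F_{\rm re}+iF_{\rm im}$ with $F_{\rm re},F_{\rm im}\in R[X,Y]$ and $\overline F=F_{\rm re}-iF_{\rm im}$ for $F\in C[X,Y]$. For a field $K$ (here $K=R$ or $K=C$), a point $x\in K$ and a nonzero polynomial $P$ in one variable $T$ over $K$, write $P=(T-x)^{{\rm mult}_x(P)}P_x$ with $P_x(x)\neq 0$, and let ${\rm val}_x(P/Q)={\rm mult}_x(P)-{\rm mult}_x(Q)$ for nonzero $P,Q$. *Cauchy index.* Let $P,Q\in R[T]$ and $x\in R$. If $P\ne0$, $Q\ne 0$ and ${\rm val}_x(P/Q)<0$, put ${\rm Ind}_x^+(P,Q)=\frac12{\rm sign}(P_x(x)Q_x(x))$ and ${\rm Ind}_x^-(P,Q)=\frac12(-1)^{{\rm val}_x(P/Q)}{\rm sign}(P_x(x)Q_x(x))$; otherwise put both equal to $0$. Let ${\rm Ind}_x={\rm Ind}_x^+-{\rm Ind}_x^-$. For $a<b$ in $R$ let $${\rm Ind}_a^b(P,Q)={\rm Ind}_a^+(P,Q)+\sum_{x\in(a,b)}{\rm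 Ind}_x(P,Q)-{\rm Ind}_b^-(P,Q),$$ let ${\rm Ind}_b^a=-{\rm Ind}_a^b$, and ${\rm Ind}_a^a=0$. *Winding number.* For $\Gamma=[x_0,x_1]\times[y_0,y_1]\subset R^2$ with $x_0<x_1$, $y_0<y_1$, and $F\in C[X,Y]$, let $$w(F\,|\,\partial\Gamma)=\tfrac12\Big({\rm Ind}_{x_0}^{x_1}(F_{\rm re}(T,y_0),F_{\rm im}(T,y_0))+{\rm Ind}_{y_0}^{y_1}(F_{\rm re}(x_1,T),F_{\rm im}(x_1,T))+{\rm Ind}_{x_1}^{x_0}(F_{\rm re}(T,y_1),F_{\rm im}(T,y_1))+{\rm Ind}_{y_1}^{y_0}(F_{\rm re}(x_0,T),F_{\rm im}(x_0,T))\Big),$$ and let $w(F/G\,|\,\partial\Gamma)=w(F\overline G\,|\,\partial\Gamma)$ for $F,G\in C[Z]$, $G\neq0$. **Theorem 1.4.** Let $F,G\in C[Z]$ with $G\ne 0$ and $F/G\in C(Z)\setminus\{0\}$, and let $\Gamma=[x_0,x_1]\times[y_0,y_1]$ with $x_0<x_1$, $y_0<y_1$ in $R$. Identify $R^2$ with $C$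 by $(x,y)\mapsto x+iy$. Suppose that ${\rm val}_z(F/G)$ is even at each of the four vertices $z$ of $\Gamma$. Then $$w(F/G\,|\,\partial\Gamma)=(N_{\rm int}-P_{\rm int})+\tfrac12(N_{\rm edge}-P_{\rm edge})+\tfrac14(N_{\rm vert}-P_{\rm vert}),$$ where $N_{\rm int},N_{\rm edge},N_{\rm vert}$ are the numbers of zeros of $F/G$, counted with multiplicity, and $P_{\rm int},P_{\rm edge},P_{\rm vert}$ the numbers of poles, counted with order, that lie respectively in the interior of $\Gamma$, on the edges of $\Gamma$ but not at a vertex, and at the vertices of $\Gamma$. -/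

import Mathlib

open Polynomial

noncomputable section

namespace AlgWinding

section RealFunctions

variable {R : Type*} [Field R] [LinearOrder R]

/-- The factor `P_x` in `P = (X - x)^{mult_x P} * P_x`, with `P_x(x) ≠ 0` when `P ≠ 0`. -/
def cofactor (x : R) (P : R[X]) : R[X] :=
  P /ₘ (X - C x) ^ P.rootMultiplicity x

/-- The valuation `val_x (P / Q) = mult_x P - mult_x Q`, for nonzero `P` and `Q`. -/
def val (x : R) (P Q : R[X]) : ℤ :=
  (P.rootMultiplicity x : ℤ) - (Q.rootMultiplicity x : ℤ)

/-- The sign (`1`, `0` or `-1`) of `P_x(x) * Q_x(x)`. -/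
def cofactorSign (x : R) (P Q : R[X]) : ℚ :=
  ((SignType.sign ((cofactor x P).eval x * (cofactor x Q).eval x) : SignType) : ℚ)

open Classical in
/-- `Ind_x^+ (P, Q)`. -/
def indRight (x : R) (P Q : R[X]) : ℚ :=
  if P ≠ 0 ∧ Q ≠ 0 ∧ val x P Q < 0 then (1 / 2) * cofactorSign x P Q else 0

open Classical in
/-- `Ind_x^- (P, Q)`. -/
def indLeft (x : R) (P Q : R[X]) : ℚ :=
  if P ≠ 0 ∧ Q ≠ 0 ∧ val x P Q < 0 then
    (1 / 2) * (-1) ^ (val x P Q) * cofactorSign x P Q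
  else 0

/-- The Cauchy index `Ind_x (P, Q)` at a point. -/
def indAt (x : R) (P Q : R[X]) : ℚ :=
  indRight x P Q - indLeft x P Q

/-- The sum defining the Cauchy index on an interval has only finitely many nonzero terms. -/
theorem finite_support_indAt (P Q : R[X]) : (Function.support fun x => indAt x P Q).Finite := by
  classical
  refine (Q.roots.toFinset.finite_toSet).subset fun x hx => ?_
  by_contra h
  apply hx
  have hQ : ¬ (P ≠ 0 ∧ Q ≠ 0 ∧ val x P Q < 0) := by
    rintro ⟨-, hQ, hv⟩
    have h0 : Q.rootMultiplicity x = 0 := by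
      rw [rootMultiplicity_eq_zero_iff]
      intro hr
      exact absurd (by simpa [hQ] using hr) h
    simp only [val, h0] at hv
    omega
  simp [indAt, indRight, indLeft, hQ]

/-- The Cauchy index from `a` to `b` when `a < b`. -/
def indInc (a b : R) (P Q : R[X]) : ℚ :=
  indRight a P Q + (∑ᶠ x ∈ Set.Ioo a b, indAt x P Q) - indLeft b P Q

/-- The Cauchy index `Ind_a^b (P, Q)`. -/
def ind (a b : R) (P Q : R[X]) : ℚ :=
  if a < b then indInc a b P Q
  else if b < a then -indInc b a P Q
  else 0

end RealFunctions

section Cplx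

/-- `R[i]`, with `i ^ 2 = -1`: the elements are `⟨re, im⟩` with `re im : R`. -/
abbrev Cplx (R : Type*) [CommRing R] := QuadraticAlgebra R (-1) 0

/-- Makes `Cplx R` a field, through Mathlib's field structure on quadratic algebras. -/
instance factSqNe (R : Type*) [Field R] [LinearOrder R] [IsStrictOrderedRing R] :
    Fact (∀ r : R, r ^ 2 ≠ -1 + 0 * r) :=
  ⟨fun r h => by nlinarith [sq_nonneg r]⟩

variable {R : Type*} [CommRing R]

/-- The real part `F_re ∈ R[X, Y]` of `F ∈ R[i][X, Y]`, taken coefficientwise. -/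
def rePart (F : MvPolynomial (Fin 2) (Cplx R)) : MvPolynomial (Fin 2) R :=
  ∑ m ∈ F.support, MvPolynomial.monomial m (F.coeff m).re

/-- The imaginary part `F_im ∈ R[X, Y]` of `F ∈ R[i][X, Y]`, taken coefficientwise. -/
def imPart (F : MvPolynomial (Fin 2) (Cplx R)) : MvPolynomial (Fin 2) R :=
  ∑ m ∈ F.support, MvPolynomial.monomial m (F.coeff m).im

/-- The conjugate polynomial `F_re - i F_im`: all coefficients are conjugated. -/
def conjPoly (F : MvPolynomial (Fin 2) (Cplx R)) : MvPolynomial (Fin 2) (Cplx R) :=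
  MvPolynomial.map (starRingEnd (Cplx R)) F

/-- The inclusion of `R[i][Z]` in `R[i][X, Y]` given by `Z = X + i Y`. -/
def incl (F : (Cplx R)[X]) : MvPolynomial (Fin 2) (Cplx R) :=
  Polynomial.aeval
    (MvPolynomial.X 0 + MvPolynomial.C (⟨0, 1⟩ : Cplx R) * MvPolynomial.X 1) F

/-- `P(T, y) ∈ R[T]` for `P ∈ R[X, Y]`. -/
def restrictHoriz (y : R) (P : MvPolynomial (Fin 2) R) : R[X] :=
  MvPolynomial.aeval ![Polynomial.X, Polynomial.C y] P

/-- `P(x, T) ∈ R[T]` for `P ∈ R[X, Y]`. -/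
def restrictVert (x : R) (P : MvPolynomial (Fin 2) R) : R[X] :=
  MvPolynomial.aeval ![Polynomial.C x, Polynomial.X] P

end Cplx

section Winding

variable {R : Type*} [Field R] [LinearOrder R] [IsStrictOrderedRing R]

/-- The winding number `w(F | ∂Γ)` of `F ∈ R[i][X, Y]` on the boundary of
`Γ = [x₀, x₁] × [y₀, y₁]`. -/
def winding (F : MvPolynomial (Fin 2) (Cplx R)) (x₀ x₁ y₀ y₁ : R) : ℚ :=
  (1 / 2) *
    (ind x₀ x₁ (restrictHoriz y₀ (rePart F)) (restrictHoriz y₀ (imPart F))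
      + ind y₀ y₁ (restrictVert x₁ (rePart F)) (restrictVert x₁ (imPart F))
      + ind x₁ x₀ (restrictHoriz y₁ (rePart F)) (restrictHoriz y₁ (imPart F))
      + ind y₁ y₀ (restrictVert x₀ (rePart F)) (restrictVert x₀ (imPart F)))

/-- The winding number `w(F / G | ∂Γ) = w(F * conj G | ∂Γ)` of a fraction of elements of
`R[i][X, Y]`. -/
def windingFrac (F G : MvPolynomial (Fin 2) (Cplx R)) (x₀ x₁ y₀ y₁ : R) : ℚ :=
  winding (F * conjPoly G) x₀ x₁ y₀ y₁

/-- The valuation at `z` of a nonzero rational function `φ ∈ R[i](Z)`. -/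
def ratVal (z : Cplx R) (φ : RatFunc (Cplx R)) : ℤ :=
  (φ.num.rootMultiplicity z : ℤ) - (φ.denom.rootMultiplicity z : ℤ)

/-- Number of zeros of `φ` in `S`, counted with multiplicity (a zero is a point of positive
valuation, and the valuation is its multiplicity). -/
def zerosIn (φ : RatFunc (Cplx R)) (S : Set (Cplx R)) : ℕ :=
  ∑ᶠ z ∈ S, (ratVal z φ).toNat

/-- Number of poles of `φ` in `S`, counted with order (a pole is a point of negative valuation,
and its order is the opposite of the valuation). -/
def polesIn (φ : RatFunc (Cplx R)) (S : Set (Cplx R)) : ℕ :=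
  ∑ᶠ z ∈ S, (-ratVal z φ).toNat

/-- A nonzero rational function has finitely many zeros and poles, so the sums `zerosIn` and
`polesIn` are finite. -/
theorem finite_support_ratVal (φ : RatFunc (Cplx R)) (hφ : φ ≠ 0) :
    (Function.support fun z => ratVal z φ).Finite := by
  classical
  refine ((φ.num * φ.denom).roots.toFinset.finite_toSet).subset fun z hz => ?_
  by_contra h
  apply hz
  have hn : φ.num ≠ 0 := RatFunc.num_ne_zero hφ
  have hd : φ.denom ≠ 0 := RatFunc.denom_ne_zero φ
  simp only [Finset.mem_coe, Multiset.mem_toFinset, mem_roots (mul_ne_zero hn hd),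
    root_mul, not_or] at h
  simp [ratVal, rootMultiplicity_eq_zero h.1, rootMultiplicity_eq_zero h.2]

/-- The four vertices of `[x₀, x₁] × [y₀, y₁]`, as points of `R[i]`. -/
def vertices (x₀ x₁ y₀ y₁ : R) : Set (Cplx R) :=
  {⟨x₀, y₀⟩, ⟨x₁, y₀⟩, ⟨x₁, y₁⟩, ⟨x₀, y₁⟩}

/-- The points of the rectangle that lie on an edge and are not vertices. -/
def edges (x₀ x₁ y₀ y₁ : R) : Set (Cplx R) :=
  {z | (x₀ < z.re ∧ z.re < x₁ ∧ (z.im = y₀ ∨ z.im = y₁)) ∨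
    (y₀ < z.im ∧ z.im < y₁ ∧ (z.re = x₀ ∨ z.re = x₁))}

/-- The interior of the rectangle. -/
def inside (x₀ x₁ y₀ y₁ : R) : Set (Cplx R) :=
  {z | x₀ < z.re ∧ z.re < x₁ ∧ y₀ < z.im ∧ z.im < y₁}

end Winding

end AlgWinding

end

/-! The Cauchy index of $(P,Q)$ on an interval counts half turns of the direction of $P+iQ$, because
it records the jumps of $P/Q$, the cotangent of the argument. It is additive on products
$(P+iQ)(U+iV)$ up to a defect. Locally the addition formula for the cotangent (`indSide_mul`) leaves
an error equal to a sign of $S=QV(PV+QU)$. By the intermediate value theorem the jumps of this sign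
telescope (`sideSign_add_finsum_sub`), so `ind_mul` carries a correction only at the two endpoints.
This correction, `argDefect`, depends only on the real lines spanned by the directions of the two
factors there.

Around the rectangle each vertex receives one correction from its horizontal edge and one from its
vertical edge, with opposite signs. For a polynomial in $Z$ with multiplicity $m$ at the vertex, the
vertical direction is $i^m$ times the horizontal one. For even $m$ this is a real factor, so the
corrections cancel and $w$ is multiplicative-to-additive (`winding_mul`). The square of a linear
factor at a vertex is also harmless, since both corrections are then zero.

As $R[i]$ is algebraically closed (Artin's argument), a polynomial splits into linear factors.
Factors with root off the vertices are removed one by one, those at a vertex in pairs. A direct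
computation gives the weights 1, 1/2 and 1/4 of a linear factor. For fractions, conjugation negates
$w$, and multiplication by the real polynomial $G\overline G$ does not change it, which reduces
$F/G$ to lowest terms. -/

noncomputable section

namespace AlgWinding

/-! ### Artin's criterion for algebraic closedness -/

section AlgebraicallyClosed

open IntermediateField in
/-- Over a field in which odd degree polynomials have roots, the degree of a finite Galois
extension is a power of two. -/
theorem exists_finrank_eq_two_pow {K L : Type*} [Field K] [Field L] [Algebra K L]
    [FiniteDimensional K L] [IsGalois K L]
    (hodd : ∀ f : K[X], Odd f.natDegree → ∃ x, f.IsRoot x) :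
    ∃ n, Module.finrank K L = 2 ^ n := by
  obtain ⟨P⟩ : Nonempty (Sylow 2 Gal(L/K)) := inferInstance
  have h2 := P.not_dvd_index
  have hfix : Module.finrank K (fixedField (P : Subgroup Gal(L/K))) =
      (P : Subgroup Gal(L/K)).index := by
    rw [finrank_eq_fixingSubgroup_index, fixingSubgroup_fixedField]
  obtain ⟨α, hα⟩ := Field.exists_primitive_element K (fixedField (P : Subgroup Gal(L/K)))
  have hdeg := (Field.primitive_element_iff_minpoly_natDegree_eq K α).1 hα
  have hint : IsIntegral K α := Algebra.IsIntegral.isIntegral α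
  -- The fixed field of a Sylow 2-subgroup has odd degree. The minimal polynomial of a generator
  -- thus has a root and, being irreducible, degree one, so the whole group is a 2-group.
  obtain ⟨x, hx⟩ := hodd (minpoly K α) (by
    rw [hdeg, hfix, ← Nat.not_even_iff_odd, even_iff_two_dvd]; exact h2)
  have h1 : (minpoly K α).natDegree = 1 := natDegree_eq_of_degree_eq_some
    (degree_eq_one_of_irreducible_of_root (minpoly.irreducible hint) hx)
  refine ⟨(Nat.card Gal(L/K)).factorization 2, ?_⟩
  rw [← P.card_eq_multiplicity, ← IsGalois.card_aut_eq_finrank K L,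
    ← (P : Subgroup Gal(L/K)).card_mul_index, ← hfix, ← hdeg, h1, mul_one]

open IntermediateField in
/-- A field in which every element is a square has no Galois extension of degree a nontrivial
power of two. -/
theorem finrank_eq_one_of_forall_isSquare {K L : Type*} [Field K] [NeZero (2 : K)] [Field L]
    [Algebra K L] [FiniteDimensional K L] [IsGalois K L] (hsq : ∀ z : K, IsSquare z) {n : ℕ}
    (hn : Module.finrank K L = 2 ^ n) : Module.finrank K L = 1 := by
  rcases n with _ | n
  · simpa using hn
  exfalso
  have hcard : Nat.card Gal(L/K) = 2 ^ (n + 1) := by rw [IsGalois.card_aut_eq_finrank, hn]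
  -- An index 2 subgroup would give a quadratic extension, which the quadratic formula excludes when
  -- discriminants are squares.
  obtain ⟨H, hH⟩ := Sylow.exists_subgroup_card_pow_prime (G := Gal(L/K)) 2 (n := n)
    (by rw [hcard, pow_succ]; exact Dvd.intro _ rfl)
  have hidx : H.index = 2 := by
    have h := H.card_mul_index
    rw [hH, hcard, pow_succ] at h
    exact Nat.eq_of_mul_eq_mul_left (by positivity) h
  have hfix : Module.finrank K (fixedField H) = 2 := by
    rw [finrank_eq_fixingSubgroup_index, fixingSubgroup_fixedField, hidx]
  obtain ⟨α, hα⟩ := Field.exists_primitive_element K (fixedField H)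
  have hdeg := (Field.primitive_element_iff_minpoly_natDegree_eq K α).1 hα
  have hint : IsIntegral K α := Algebra.IsIntegral.isIntegral α
  replace hdeg := hdeg.trans hfix
  have hlead : (minpoly K α).coeff 2 = 1 := by
    have := (minpoly.monic hint).coeff_natDegree
    rwa [hdeg] at this
  obtain ⟨x, hx⟩ := exists_quadratic_eq_zero (K := K) (a := 1) (b := (minpoly K α).coeff 1)
    (c := (minpoly K α).coeff 0) one_ne_zero (hsq _)
  have hroot : (minpoly K α).IsRoot x := by
    rw [IsRoot.def, eval_eq_sum_range, hdeg]
    simp only [Finset.sum_range_succ, Finset.sum_range_zero, hlead]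
    linear_combination hx
  have h1 : (minpoly K α).natDegree = 1 := natDegree_eq_of_degree_eq_some
    (degree_eq_one_of_irreducible_of_root (minpoly.irreducible hint) hroot)
  omega

/-- Artin's criterion: if `K` has roots of odd degree polynomials and every element of the
finite extension `K'` is a square, then `K'` is algebraically closed. -/
theorem isAlgClosed_of_isSquare_of_odd {K K' : Type*} [Field K] [CharZero K] [Field K']
    [Algebra K K'] [FiniteDimensional K K']
    (hodd : ∀ f : K[X], Odd f.natDegree → ∃ x, f.IsRoot x) (hsq : ∀ z : K', IsSquare z) :
    IsAlgClosed K' := by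
  refine IsAlgClosed.of_exists_root K' fun p hpm hp => ?_
  have : Fact (Irreducible p) := ⟨hp⟩
  have : CharZero K' := charZero_of_injective_algebraMap (algebraMap K K').injective
  have : FiniteDimensional K' (AdjoinRoot p) := hpm.finite_adjoinRoot
  have : FiniteDimensional K (AdjoinRoot p) := FiniteDimensional.trans K K' (AdjoinRoot p)
  let Ω := AlgebraicClosure (AdjoinRoot p)
  -- The closure is taken over `K`, not `K'`: the odd degree hypothesis needs `L` Galois over `K`,
  -- and then `L` is Galois over `K'` of degree dividing a power of two.
  let L := IntermediateField.normalClosure K (AdjoinRoot p) Ω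
  have : Algebra.IsAlgebraic K Ω := Algebra.IsAlgebraic.trans K (AdjoinRoot p) Ω
  have : IsAlgClosure K Ω := ⟨inferInstance, inferInstance⟩
  have : Normal K Ω := IsAlgClosure.normal K Ω
  have : IsGalois K L := ⟨⟩
  let : Algebra K' L := ((algebraMap (AdjoinRoot p) L).comp (algebraMap K' (AdjoinRoot p))).toAlgebra
  have : IsScalarTower K' (AdjoinRoot p) L := IsScalarTower.of_algebraMap_eq fun _ => rfl
  have : IsScalarTower K K' L := IsScalarTower.of_algebraMap_eq fun x => by
    rw [IsScalarTower.algebraMap_apply K (AdjoinRoot p) L,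
      IsScalarTower.algebraMap_apply K K' (AdjoinRoot p)]
    rfl
  have : FiniteDimensional K' L := FiniteDimensional.right K K' L
  have : IsGalois K' L := IsGalois.tower_top_of_isGalois K K' L
  obtain ⟨n, hn⟩ := exists_finrank_eq_two_pow (K := K) (L := L) hodd
  have hdvd : Module.finrank K' L ∣ 2 ^ n := hn ▸ Dvd.intro_left _ (Module.finrank_mul_finrank K K' L)
  obtain ⟨m, -, hm⟩ := (Nat.dvd_prime_pow Nat.prime_two).1 hdvd
  have h1 := finrank_eq_one_of_forall_isSquare hsq hm
  rw [← Module.finrank_mul_finrank K' (AdjoinRoot p) L] at h1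
  have h2 : p.natDegree = 1 := by
    rw [← (AdjoinRoot.powerBasis hp.ne_zero).finrank.trans (AdjoinRoot.powerBasis_dim hp.ne_zero)]
    exact Nat.eq_one_of_mul_eq_one_right h1
  exact exists_root_of_degree_eq_one (by rw [degree_eq_natDegree hp.ne_zero, h2]; rfl)

end AlgebraicallyClosed

/-! ### Real closed fields: $R[i]$ and the intermediate value theorem -/

section RealClosed

variable {R : Type*} [Field R] [LinearOrder R] [IsStrictOrderedRing R] [IsRealClosed R]

/-- With $r=|z|$, a root of $a+ib$ is $u\pm iv$ where $u^2=(r+a)/2$ and $v^2=(r-a)/2$. Then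
$2uv=|b|$, and the sign of $b$ decides the sign of $v$. -/
theorem isSquare_cplx (z : Cplx R) : IsSquare z := by
  have key : ∀ a : R, 0 ≤ a → ∃ s, 0 ≤ s ∧ s * s = a := fun a ha => by
    obtain ⟨s, hs⟩ := IsSquare.of_nonneg ha
    exact ⟨|s|, abs_nonneg s, by rw [abs_mul_abs_self, hs]⟩
  obtain ⟨a, b⟩ := z
  obtain ⟨r, hr0, hr⟩ := key (a * a + b * b)
    (add_nonneg (mul_self_nonneg a) (mul_self_nonneg b))
  have h1 : |a| ≤ r := abs_le_of_sq_le_sq (by nlinarith [mul_self_nonneg b]) hr0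
  obtain ⟨h2, h3⟩ := abs_le.1 h1
  obtain ⟨u, hu0, hu⟩ := key ((r + a) / 2) (by linarith)
  obtain ⟨v, hv0, hv⟩ := key ((r - a) / 2) (by linarith)
  have huv : (2 * (u * v)) * (2 * (u * v)) = b * b := by
    linear_combination (4 * v * v) * hu + 2 * (r + a) * hv + hr
  rcases le_total 0 b with hb | hb
  · have : 2 * (u * v) = b := by
      have h0 : 0 ≤ 2 * (u * v) := by positivity
      exact (mul_self_inj h0 hb).1 huv
    refine ⟨⟨u, v⟩, ?_⟩
    ext
    · simp; linear_combination hv - hu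
    · simp; linear_combination - this
  · have : 2 * (u * v) = -b := by
      have h0 : 0 ≤ 2 * (u * v) := by positivity
      exact (mul_self_inj h0 (by linarith)).1 (by linear_combination huv)
    refine ⟨⟨u, -v⟩, ?_⟩
    ext
    · simp; linear_combination hv - hu
    · simp; linear_combination this

instance isAlgClosed_cplx : IsAlgClosed (Cplx R) :=
  isAlgClosed_of_isSquare_of_odd (K := R)
    (fun _ hf => IsRealClosed.exists_isRoot_of_odd_natDegree hf) isSquare_cplx

/-- A nonconstant polynomial over a real closed field has a factor `X - x` or
`(X - x) ^ 2 + y ^ 2` with `y ≠ 0`. -/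
theorem exists_dvd_of_natDegree_ne_zero {P : R[X]} (hP : P.natDegree ≠ 0) :
    (∃ x, X - C x ∣ P) ∨ ∃ x y, y ≠ 0 ∧ (X - C x) ^ 2 + C (y ^ 2) ∣ P := by
  obtain ⟨z, hz⟩ := IsAlgClosed.exists_aeval_eq_zero (Cplx R) P
    (fun h => hP (natDegree_eq_of_degree_eq_some h))
  by_cases hy : z.im = 0
  · left
    refine ⟨z.re, dvd_iff_isRoot.2 ?_⟩
    have : z = algebraMap R (Cplx R) z.re := by ext <;> simp [hy]
    rw [this, aeval_algebraMap_apply] at hz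
    simpa using hz
  · right
    refine ⟨z.re, z.im, hy, ?_⟩
    set q : R[X] := (X - C z.re) ^ 2 + C (z.im ^ 2) with hq
    have hqm : q.Monic := by
      rw [hq]; monicity!
    have hqd : q.natDegree = 2 := by
      rw [hq]; compute_degree!
    have hqz : aeval z q = 0 := by
      rw [hq]
      ext <;> simp [pow_two]
    have hrem : aeval z (P %ₘ q) = 0 := by
      have := congrArg (aeval z) (modByMonic_add_div P q)
      rwa [map_add, map_mul, hqz, zero_mul, add_zero, hz] at this
    -- The remainder is a real polynomial of degree at most 1 vanishing at the nonreal `z`, hence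
    -- zero.
    rw [← modByMonic_eq_zero_iff_dvd hqm]
    have hlt := natDegree_modByMonic_lt P hqm (by rintro h; rw [h] at hqd; simp at hqd)
    rw [hqd] at hlt
    obtain ⟨a, b, hab⟩ := exists_eq_X_add_C_of_natDegree_le_one (Nat.le_of_lt_succ hlt)
    rw [hab] at hrem ⊢
    have him := congrArg QuadraticAlgebra.im hrem
    have hre := congrArg QuadraticAlgebra.re hrem
    simp [hy] at him hre
    subst him
    simp at hre
    simp [hre]

/-- The intermediate value theorem for polynomials over a real closed field. -/
theorem sign_eval_eq_of_forall_not_isRoot {a b : R} (hab : a ≤ b) (P : R[X])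
    (hP : ∀ x ∈ Set.Icc a b, ¬ P.IsRoot x) :
    SignType.sign (P.eval a) = SignType.sign (P.eval b) := by
  induction hn : P.natDegree using Nat.strong_induction_on generalizing P with
  | _ n ih =>
    by_cases h0 : P.natDegree = 0
    · rw [eq_C_of_natDegree_eq_zero h0]; simp
    have hP0 : P ≠ 0 := by rintro rfl; simp at h0
    -- A linear factor has its root outside the interval, so it keeps its sign there; a quadratic
    -- factor is positive everywhere.
    rcases exists_dvd_of_natDegree_ne_zero h0 with ⟨x, Q, rfl⟩ | ⟨x, y, hy, Q, rfl⟩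
    · have hQ := ih Q.natDegree (by
        rw [← hn, natDegree_mul (X_sub_C_ne_zero x) (right_ne_zero_of_mul hP0)]; simp) Q
        (fun t ht h => hP t ht (by simp_all)) rfl
      have hx : x < a ∨ b < x := by
        by_contra! h
        exact hP x h (by simp)
      simp only [eval_mul, eval_sub, eval_X, eval_C, sign_mul, hQ]
      congr 1
      rcases hx with hx | hx
      · rw [sign_pos (by linarith), sign_pos (by linarith)]
      · rw [sign_neg (by linarith), sign_neg (by linarith)]
    · have hq : ((X - C x) ^ 2 + C (y ^ 2) : R[X]).natDegree = 2 := by compute_degree!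
      have hQ := ih Q.natDegree (by
        rw [← hn, natDegree_mul (left_ne_zero_of_mul hP0) (right_ne_zero_of_mul hP0), hq]
        omega) Q (fun t ht h => hP t ht (by simp_all)) rfl
      simp only [eval_mul, eval_sub, eval_X, eval_C, eval_add, eval_pow, sign_mul, hQ]
      congr 1
      rw [sign_pos (by positivity), sign_pos (by positivity)]

end RealClosed

/-! ### One-sided signs and indices -/

section OneSided

variable {R : Type*} [Field R] [LinearOrder R]

/-- The sign of an element, as a rational number. -/
def sgn (r : R) : ℚ := ((SignType.sign r : SignType) : ℚ)

/-- The sign of `P` just to the right (`ε = 1`) or just to the left (`ε = -1`) of `x`. -/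
def sideSign (ε : ℚ) (x : R) (P : R[X]) : ℚ :=
  ε ^ P.rootMultiplicity x * sgn ((cofactor x P).eval x)

/-- The one-sided Cauchy index: `Ind_x^+` for `ε = 1` and `Ind_x^-` for `ε = -1`. -/
def indSide (ε : ℚ) (x : R) (P Q : R[X]) : ℚ :=
  if val x P Q < 0 then (1 / 2) * (sideSign ε x P * sideSign ε x Q) else 0

@[simp] theorem sgn_zero : sgn (0 : R) = 0 := by simp [sgn]

theorem sgn_of_pos {r : R} (h : 0 < r) : sgn r = 1 := by simp [sgn, h]

theorem sgn_of_neg {r : R} (h : r < 0) : sgn r = -1 := by simp [sgn, h]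

theorem sgn_cases {r : R} (h : r ≠ 0) : sgn r = 1 ∨ sgn r = -1 := by
  rcases lt_or_gt_of_ne h with h | h
  · exact .inr (sgn_of_neg h)
  · exact .inl (sgn_of_pos h)

-- This value makes `indSide` vanish on zero polynomials, as the conditions `P ≠ 0` and `Q ≠ 0` do
-- in `indRight` and `indLeft`.
@[simp] theorem sideSign_zero (ε : ℚ) (x : R) : sideSign ε x 0 = 0 := by
  simp [sideSign, cofactor]

theorem exists_eq_pow_mul {K : Type*} [Field K] (x : K) {P : K[X]} (hP : P ≠ 0) :
    ∃ m A, P = (X - C x) ^ m * A ∧ A.eval x ≠ 0 := by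
  obtain ⟨A, hA, hA'⟩ := exists_eq_pow_rootMultiplicity_mul_and_not_dvd P hP x
  exact ⟨_, A, hA, by rwa [dvd_iff_isRoot] at hA'⟩

theorem rootMultiplicity_pow_mul {K : Type*} [Field K] (x : K) (m : ℕ) {A : K[X]}
    (hA : A.eval x ≠ 0) :
    ((X - C x) ^ m * A).rootMultiplicity x = m := by
  have h0 : A ≠ 0 := by rintro rfl; simp at hA
  rw [rootMultiplicity_mul (mul_ne_zero (pow_ne_zero _ (X_sub_C_ne_zero x)) h0),
    rootMultiplicity_X_sub_C_pow, rootMultiplicity_eq_zero hA, add_zero]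

theorem sideSign_pow_mul (ε : ℚ) (x : R) (m : ℕ) {A : R[X]} (hA : A.eval x ≠ 0) :
    sideSign ε x ((X - C x) ^ m * A) = ε ^ m * sgn (A.eval x) := by
  rw [sideSign, rootMultiplicity_pow_mul x m hA, cofactor, rootMultiplicity_pow_mul x m hA,
    mul_divByMonic_cancel_left _ ((monic_X_sub_C x).pow m)]

theorem sideSign_of_eval_ne_zero (ε : ℚ) (x : R) {P : R[X]} (hP : P.eval x ≠ 0) :
    sideSign ε x P = sgn (P.eval x) := by
  simpa using sideSign_pow_mul ε x 0 hP

theorem sideSign_cases {ε : ℚ} (hε : ε = 1 ∨ ε = -1) (x : R) {P : R[X]} (hP : P ≠ 0) :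
    sideSign ε x P = 1 ∨ sideSign ε x P = -1 := by
  obtain ⟨m, A, rfl, hA⟩ := exists_eq_pow_mul x hP
  rw [sideSign_pow_mul ε x m hA]
  rcases hε with rfl | rfl <;> rcases neg_one_pow_eq_or ℚ m with h | h <;>
    rcases sgn_cases hA with h' | h' <;> simp [h, h']

theorem sideSign_mul_self {ε : ℚ} (hε : ε = 1 ∨ ε = -1) (x : R) {P : R[X]} (hP : P ≠ 0) :
    sideSign ε x P * sideSign ε x P = 1 := by
  rcases sideSign_cases hε x hP with h | h <;> simp [h]

theorem sgn_mul_self {r : R} (h : r ≠ 0) : sgn r * sgn r = 1 := by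
  rcases sgn_cases h with h | h <;> simp [h]

/-- The one-sided index of a pair without common root at `x`. -/
theorem indSide_of_not_common_root (ε : ℚ) (x : R) {P Q : R[X]}
    (h : P.eval x ≠ 0 ∨ Q.eval x ≠ 0) :
    indSide ε x P Q = if Q.eval x = 0 then (1 / 2) * (sgn (P.eval x) * sideSign ε x Q) else 0 := by
  by_cases hQ : Q.eval x = 0
  · have hP : P.eval x ≠ 0 := h.resolve_right (not_not_intro hQ)
    rw [indSide, if_pos hQ, sideSign_of_eval_ne_zero ε x hP]
    rcases eq_or_ne Q 0 with rfl | hQ0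
    · simp
    · have h1 := (rootMultiplicity_pos hQ0).2 hQ
      rw [if_pos]
      rw [val, rootMultiplicity_eq_zero hP]
      omega
  · rw [indSide, if_neg hQ, if_neg]
    rw [val, rootMultiplicity_eq_zero hQ]
    omega

theorem sideSign_one_eq_neg_one {x : R} {S : R[X]} (h : S.eval x ≠ 0) :
    sideSign 1 x S = sideSign (-1) x S := by
  rw [sideSign_of_eval_ne_zero _ x h, sideSign_of_eval_ne_zero _ x h]

theorem finite_support_sideSign (S : R[X]) :
    (Function.support fun x => sideSign 1 x S - sideSign (-1) x S).Finite := by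
  classical
  rcases eq_or_ne S 0 with rfl | hS
  · simp
  refine S.roots.toFinset.finite_toSet.subset fun x hx => ?_
  by_contra h
  refine hx ?_
  simp only [Finset.mem_coe, Multiset.mem_toFinset, mem_roots hS, IsRoot.def] at h
  simp [sideSign_one_eq_neg_one h]

end OneSided

/-! ### Sign rules and the local addition formula -/

section OneSidedOrdered

variable {R : Type*} [Field R] [LinearOrder R] [IsStrictOrderedRing R]

theorem sgn_mul (r s : R) : sgn (r * s) = sgn r * sgn s := by simp [sgn, sign_mul]

theorem sgn_neg (r : R) : sgn (-r) = -sgn r := by simp [sgn, Left.sign_neg]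

theorem indRight_eq_indSide (x : R) (P Q : R[X]) : indRight x P Q = indSide 1 x P Q := by
  unfold indRight indSide
  rcases eq_or_ne P 0 with rfl | hP
  · simp
  rcases eq_or_ne Q 0 with rfl | hQ
  · simp
  simp only [ne_eq, hP, hQ, not_false_eq_true, true_and]
  congr 1
  have h : cofactorSign x P Q = sgn ((cofactor x P).eval x) * sgn ((cofactor x Q).eval x) :=
    sgn_mul _ _
  rw [h, sideSign, sideSign, one_pow, one_pow, one_mul, one_mul]

theorem indLeft_eq_indSide (x : R) (P Q : R[X]) : indLeft x P Q = indSide (-1) x P Q := by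
  unfold indLeft indSide
  rcases eq_or_ne P 0 with rfl | hP
  · simp
  rcases eq_or_ne Q 0 with rfl | hQ
  · simp
  simp only [ne_eq, hP, hQ, not_false_eq_true, true_and]
  congr 1
  have h1 : ((-1 : ℚ)) ^ (val x P Q) =
      (-1) ^ P.rootMultiplicity x * (-1) ^ Q.rootMultiplicity x := by
    rw [val, zpow_sub₀ (by norm_num), zpow_natCast, zpow_natCast, div_eq_mul_inv,
      ← inv_pow]
    norm_num
  have h2 : cofactorSign x P Q = sgn ((cofactor x P).eval x) * sgn ((cofactor x Q).eval x) :=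
    sgn_mul _ _
  rw [h1, h2, sideSign, sideSign]
  ring

theorem sideSign_mul (ε : ℚ) (x : R) (P Q : R[X]) :
    sideSign ε x (P * Q) = sideSign ε x P * sideSign ε x Q := by
  rcases eq_or_ne P 0 with rfl | hP
  · simp
  rcases eq_or_ne Q 0 with rfl | hQ
  · simp
  obtain ⟨m, A, rfl, hA⟩ := exists_eq_pow_mul x hP
  obtain ⟨n, B, rfl, hB⟩ := exists_eq_pow_mul x hQ
  have : (X - C x) ^ m * A * ((X - C x) ^ n * B) = (X - C x) ^ (m + n) * (A * B) := by ring
  rw [this, sideSign_pow_mul ε x m hA, sideSign_pow_mul ε x n hB,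
    sideSign_pow_mul ε x (m + n) (by rw [eval_mul]; exact mul_ne_zero hA hB), eval_mul, sgn_mul]
  ring

theorem sideSign_neg (ε : ℚ) (x : R) (P : R[X]) : sideSign ε x (-P) = -sideSign ε x P := by
  have h : sideSign ε x (-1 : R[X]) = -1 := by
    rw [sideSign_of_eval_ne_zero] <;> simp [sgn]
  rw [← neg_one_mul, sideSign_mul, h, neg_one_mul]

theorem sgn_add {r s : R} (h : sgn r = sgn s) : sgn (r + s) = sgn r := by
  rcases lt_trichotomy r 0 with hr | rfl | hr
  · rcases lt_trichotomy s 0 with hs | rfl | hs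
    · rw [sgn_of_neg hr, sgn_of_neg (add_neg hr hs)]
    · rw [add_zero]
    · rw [sgn_of_neg hr, sgn_of_pos hs] at h; norm_num at h
  · rw [zero_add, h]
  · rcases lt_trichotomy s 0 with hs | rfl | hs
    · rw [sgn_of_pos hr, sgn_of_neg hs] at h; norm_num at h
    · rw [add_zero]
    · rw [sgn_of_pos hr, sgn_of_pos (add_pos hr hs)]

/-- If the multiplicities at `x` differ, the smaller one dominates the sum; if they agree, the
cofactors have values of the same sign, which cannot cancel. -/
theorem sideSign_add {ε : ℚ} (hε : ε = 1 ∨ ε = -1) (x : R) {P Q : R[X]}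
    (h : sideSign ε x P = sideSign ε x Q) : sideSign ε x (P + Q) = sideSign ε x P := by
  rcases eq_or_ne P 0 with rfl | hP
  · rw [zero_add, h]
  rcases eq_or_ne Q 0 with rfl | hQ
  · rw [add_zero]
  have hε0 : ε ≠ 0 := by rcases hε with rfl | rfl <;> norm_num
  obtain ⟨m, A, rfl, hA⟩ := exists_eq_pow_mul x hP
  obtain ⟨n, B, rfl, hB⟩ := exists_eq_pow_mul x hQ
  have key : ∀ (m n : ℕ) (A B : R[X]), A.eval x ≠ 0 → m < n →
      sideSign ε x ((X - C x) ^ m * A + (X - C x) ^ n * B) =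
        sideSign ε x ((X - C x) ^ m * A) := by
    intro m n A B hA hmn
    obtain ⟨k, rfl⟩ := Nat.exists_eq_add_of_lt hmn
    have h1 : (X - C x) ^ m * A + (X - C x) ^ (m + k + 1) * B =
      (X - C x) ^ m * (A + (X - C x) ^ (k + 1) * B) := by ring
    have h2 : (A + (X - C x) ^ (k + 1) * B).eval x = A.eval x := by simp
    rw [h1, sideSign_pow_mul ε x m (by rwa [h2]), sideSign_pow_mul ε x m hA, h2]
  rcases lt_trichotomy m n with hmn | rfl | hmn
  · exact key m n A B hA hmn
  · rw [sideSign_pow_mul ε x m hA, sideSign_pow_mul ε x m hB] at h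
    have h1 := mul_left_cancel₀ (pow_ne_zero m hε0) h
    have h2 := sgn_add h1
    have h3 : (A + B).eval x ≠ 0 := by
      intro h0
      rw [← eval_add, h0, sgn_zero] at h2
      rcases sgn_cases hA with h4 | h4 <;> rw [h4] at h2 <;> norm_num at h2
    rw [← mul_add, sideSign_pow_mul ε x m h3, sideSign_pow_mul ε x m hA, eval_add, h2]
  · rw [h, add_comm]
    exact key n m B A hB hmn

theorem indSide_mul_mul {ε : ℚ} (hε : ε = 1 ∨ ε = -1) (x : R) {S : R[X]} (hS : S ≠ 0)
    (P Q : R[X]) : indSide ε x (S * P) (S * Q) = indSide ε x P Q := by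
  rcases eq_or_ne P 0 with rfl | hP
  · simp [indSide]
  rcases eq_or_ne Q 0 with rfl | hQ
  · simp [indSide]
  have hv : val x (S * P) (S * Q) = val x P Q := by
    rw [val, val, rootMultiplicity_mul (mul_ne_zero hS hP),
      rootMultiplicity_mul (mul_ne_zero hS hQ)]
    push_cast
    ring
  rw [indSide, indSide, hv, sideSign_mul, sideSign_mul]
  congr 2
  linear_combination (sideSign ε x P * sideSign ε x Q) * sideSign_mul_self hε x hS

theorem indSide_neg_right (ε : ℚ) (x : R) (P Q : R[X]) :
    indSide ε x P (-Q) = -indSide ε x P Q := by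
  have hv : val x P (-Q) = val x P Q := by
    rcases eq_or_ne Q 0 with rfl | hQ
    · simp
    · rw [val, val, ← neg_one_mul, rootMultiplicity_mul (by simpa using hQ),
        rootMultiplicity_eq_zero (p := -1) (by simp), zero_add]
  rw [indSide, indSide, hv, sideSign_neg]
  split_ifs <;> ring

/-- The local form of the addition formula for the cotangent. -/
theorem indSide_mul {ε : ℚ} (hε : ε = 1 ∨ ε = -1) (x : R) {P Q U V : R[X]}
    (hf : P.eval x ≠ 0 ∨ Q.eval x ≠ 0) (hg : U.eval x ≠ 0 ∨ V.eval x ≠ 0) :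
    indSide ε x (P * U - Q * V) (P * V + Q * U) =
      indSide ε x P Q + indSide ε x U V
        + (1 / 2) * (sgn (Q.eval x) * sgn (V.eval x) * sgn ((P * V + Q * U).eval x))
        - (1 / 2) * (sideSign ε x Q * sideSign ε x V * sideSign ε x (P * V + Q * U)) := by
  have hsq : ∀ a b : R, a ≠ 0 ∨ b ≠ 0 → 0 < a ^ 2 + b ^ 2 := by
    rintro a b (h | h) <;> positivity
  have hfg : (P * U - Q * V).eval x ≠ 0 ∨ (P * V + Q * U).eval x ≠ 0 := by
    -- The squared norm of the product is the product of the squared norms, which are positive.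
    by_contra! h
    have h1 := mul_pos (hsq _ _ hf) (hsq _ _ hg)
    simp only [eval_sub, eval_add, eval_mul] at h
    nlinarith [h.1, h.2]
  rw [indSide_of_not_common_root ε x hf, indSide_of_not_common_root ε x hg,
    indSide_of_not_common_root ε x hfg]
  set M := P * V + Q * U with hM
  by_cases hQ : Q.eval x = 0
  · have hP := hf.resolve_right (not_not_intro hQ)
    by_cases hV : V.eval x = 0
    · have hU := hg.resolve_right (not_not_intro hV)
      have hMx : M.eval x = 0 := by simp [hM, hQ, hV]
      have hNx : (P * U - Q * V).eval x = P.eval x * U.eval x := by simp [hQ]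
      rw [if_pos hQ, if_pos hV, if_pos hMx, hNx, hQ, sgn_mul, sgn_zero]
      have e1 := sideSign_mul ε x P V
      have e2 := sideSign_mul ε x Q U
      rw [sideSign_of_eval_ne_zero ε x hP] at e1
      rw [sideSign_of_eval_ne_zero ε x hU] at e2
      have c1 : P * V = 0 → sideSign ε x M = sideSign ε x (Q * U) := fun h => by rw [hM, h, zero_add]
      have c2 : Q * U = 0 → sideSign ε x M = sideSign ε x (P * V) := fun h => by rw [hM, h, add_zero]
      have c3 : sideSign ε x (P * V) = sideSign ε x (Q * U) →
        sideSign ε x M = sideSign ε x (P * V) := sideSign_add hε x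
      rw [e1, e2] at c3
      rw [e1] at c2
      rw [e2] at c1
      rcases eq_or_ne Q 0 with rfl | hQ0
      · rw [c2 (zero_mul _), sideSign_zero]
        linear_combination (1 / 2 * sgn (U.eval x) * sideSign ε x V) * sgn_mul_self hP
      rcases eq_or_ne V 0 with rfl | hV0
      · rw [c1 (mul_zero _), sideSign_zero]
        linear_combination (1 / 2 * sgn (P.eval x) * sideSign ε x Q) * sgn_mul_self hU
      clear e1 e2 c1 c2
      -- If `P * V` and `Q * U` have the same side sign, `c3` gives the sign of `M`. If the signs
      -- are opposite, the formula holds whatever the sign of `M`.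
      rcases sgn_cases hP with hp | hp <;> rcases sgn_cases hU with hu | hu <;>
        rcases sideSign_cases hε x hQ0 with hq | hq <;>
        rcases sideSign_cases hε x hV0 with hv | hv <;>
        rw [hp, hu, hq, hv] at c3 <;> rw [hp, hu, hq, hv] <;> norm_num at c3 ⊢ <;>
        (try rw [c3]) <;> norm_num
    · have hMx : M.eval x = P.eval x * V.eval x := by simp [hM, hQ]
      have hMx0 : M.eval x ≠ 0 := hMx ▸ mul_ne_zero hP hV
      rw [if_pos hQ, if_neg hV, if_neg hMx0, sideSign_of_eval_ne_zero ε x hMx0, hMx,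
        sideSign_of_eval_ne_zero ε x hV, sgn_mul, hQ, sgn_zero]
      linear_combination (1 / 2 * sgn (P.eval x) * sideSign ε x Q) * sgn_mul_self hV
  · by_cases hV : V.eval x = 0
    · have hU := hg.resolve_right (not_not_intro hV)
      have hMx : M.eval x = Q.eval x * U.eval x := by simp [hM, hV]
      have hMx0 : M.eval x ≠ 0 := hMx ▸ mul_ne_zero hQ hU
      rw [if_neg hQ, if_pos hV, if_neg hMx0, sideSign_of_eval_ne_zero ε x hMx0, hMx,
        sideSign_of_eval_ne_zero ε x hQ, sgn_mul, hV, sgn_zero]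
      linear_combination (1 / 2 * sgn (U.eval x) * sideSign ε x V) * sgn_mul_self hQ
    · rw [if_neg hQ, if_neg hV, sideSign_of_eval_ne_zero ε x hQ, sideSign_of_eval_ne_zero ε x hV]
      by_cases hMx : M.eval x = 0
      · rw [if_pos hMx, hMx, sgn_zero]
        -- Substituting $PV=-QU$, valid at a root of `M`, determines the sign of the real part.
        have h1 : (P * U - Q * V).eval x * V.eval x =
            -(Q.eval x * (U.eval x ^ 2 + V.eval x ^ 2)) := by
          simp only [hM, eval_add, eval_mul] at hMx
          simp only [eval_sub, eval_mul]
          linear_combination U.eval x * hMx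
        have h2 := congrArg sgn h1
        rw [sgn_mul, sgn_neg, sgn_mul, sgn_of_pos (hsq _ _ hg)] at h2
        linear_combination (1 / 2 * sgn (V.eval x) * sideSign ε x M) * h2 -
          (1 / 2 * sgn ((P * U - Q * V).eval x) * sideSign ε x M) * sgn_mul_self hV
      · rw [if_neg hMx, sideSign_of_eval_ne_zero ε x hMx]
        ring

end OneSidedOrdered

/-! ### Telescoping of sign jumps -/

section Telescoping

variable {R : Type*} [Field R] [LinearOrder R] [IsStrictOrderedRing R]

/-- Without roots in the open interval, the signs at both ends agree. -/
theorem sideSign_eq_of_forall_not_isRoot [IsRealClosed R] {a b : R} (hab : a < b) (S : R[X])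
    (h : ∀ x ∈ Set.Ioo a b, ¬ S.IsRoot x) : sideSign 1 a S = sideSign (-1) b S := by
  rcases eq_or_ne S 0 with rfl | hS
  · simp
  obtain ⟨m, A, rfl, hA⟩ := exists_eq_pow_mul a hS
  obtain ⟨n, B, rfl, hB⟩ := exists_eq_pow_mul b (right_ne_zero_of_mul hS)
  have hBa : B.eval a ≠ 0 := fun h0 => hA (by simp [h0])
  -- Here $S=(X-a)^m(X-b)^nB$ with `B` root-free on the closed interval. At both ends $(X-a)^m$
  -- contributes the sign $1$ and $(X-b)^n$ the sign $(-1)^n$.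
  have hsign := sign_eval_eq_of_forall_not_isRoot hab.le B (by
    intro x hx hroot
    rcases eq_or_lt_of_le hx.1 with rfl | h1
    · exact hBa hroot
    rcases eq_or_lt_of_le hx.2 with rfl | h2
    · exact hB hroot
    exact h x ⟨h1, h2⟩ (by simp_all))
  have hs : sgn (B.eval a) = sgn (B.eval b) := by rw [sgn, sgn, hsign]
  have e1 : sideSign 1 a (X - C b) = -1 := by
    rw [sideSign_of_eval_ne_zero _ _ (by simpa using sub_ne_zero.2 hab.ne)]
    exact sgn_of_neg (by simpa using hab)
  have e2 : sideSign (-1) b (X - C a) = 1 := by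
    rw [sideSign_of_eval_ne_zero _ _ (by simpa using sub_ne_zero.2 hab.ne')]
    exact sgn_of_pos (by simpa using hab)
  have hpow : ∀ (ε : ℚ) (x : R) (k : ℕ) (A : R[X]),
      sideSign ε x (A ^ k) = sideSign ε x A ^ k := by
    intro ε x k A
    induction k with
    | zero => rw [pow_zero, pow_zero, sideSign_of_eval_ne_zero] <;> simp [sgn]
    | succ k ih => rw [pow_succ, pow_succ, sideSign_mul, ih]
  rw [sideSign_pow_mul 1 a m hA, sideSign_mul (-1) b, hpow, e2, sideSign_pow_mul (-1) b n hB,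
    ← sideSign_of_eval_ne_zero 1 a hA, sideSign_mul, hpow, e1, sideSign_of_eval_ne_zero 1 a hBa,
    hs]

/-- The jumps of the sign of a polynomial add up to the difference of the signs at both ends. -/
theorem sideSign_add_finsum_sub [IsRealClosed R] {a b : R} (hab : a < b) (S : R[X]) :
    sideSign 1 a S + (∑ᶠ x ∈ Set.Ioo a b, (sideSign 1 x S - sideSign (-1) x S)) =
      sideSign (-1) b S := by
  classical
  rcases eq_or_ne S 0 with rfl | hS
  · simp
  induction hn : (S.roots.toFinset.filter (· ∈ Set.Ioo a b)).card using Nat.strong_induction_on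
    generalizing a b with
  | _ n ih =>
    by_cases h : ∃ r ∈ Set.Ioo a b, S.IsRoot r
    · obtain ⟨r, hr, hroot⟩ := h
      have hrT : r ∈ S.roots.toFinset.filter (· ∈ Set.Ioo a b) := by
        rw [Finset.mem_filter, Multiset.mem_toFinset, mem_roots hS]; exact ⟨hroot, hr⟩
      have h1 := ih _ (by
        rw [← hn]
        refine Finset.card_lt_card (Finset.ssubset_iff_of_subset ?_ |>.2 ⟨r, hrT, by simp⟩)
        intro x hx
        simp only [Finset.mem_filter, Set.mem_Ioo] at hx ⊢
        exact ⟨hx.1, hx.2.1, hx.2.2.trans hr.2⟩) hr.1 rfl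
      have h2 := ih _ (by
        rw [← hn]
        refine Finset.card_lt_card (Finset.ssubset_iff_of_subset ?_ |>.2 ⟨r, hrT, by simp⟩)
        intro x hx
        simp only [Finset.mem_filter, Set.mem_Ioo] at hx ⊢
        exact ⟨hx.1, hr.1.trans hx.2.1, hx.2.2⟩) hr.2 rfl
      have hset : Set.Ioo a b = Set.Ioo a r ∪ insert r (Set.Ioo r b) := by
        rw [Set.Ioo_insert_left hr.2, Set.Ioo_union_Ico_eq_Ioo hr.1 hr.2.le]
      have hfin := finite_support_sideSign S
      rw [hset, finsum_mem_union' _ (hfin.subset Set.inter_subset_right)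
        (hfin.subset Set.inter_subset_right),
        finsum_mem_insert' _ (by simp) (hfin.subset Set.inter_subset_right)]
      · linear_combination h1 + h2
      · rw [Set.Ioo_insert_left hr.2]
        exact Set.disjoint_left.2 fun x hx hx' => (hx.2.trans_le hx'.1).false
    · push Not at h
      rw [finsum_mem_congr rfl (fun x hx => by
        rw [sideSign_one_eq_neg_one (h x hx), sub_self]), finsum_mem_zero, add_zero]
      exact sideSign_eq_of_forall_not_isRoot hab S h

/-- A local addition formula, with an error that is a jump of the sign of a polynomial, sums up
to an addition formula on an interval. -/
theorem ind_eq_add_of_indSide [IsRealClosed R] {a b : R} (hab : a < b) {N M P Q U V : R[X]}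
    (S : R[X]) (κ : R → ℚ)
    (h : ∀ x ε, ε = 1 ∨ ε = -1 → indSide ε x N M =
      indSide ε x P Q + indSide ε x U V + (1 / 2) * κ x - (1 / 2) * sideSign ε x S) :
    ind a b N M = ind a b P Q + ind a b U V - (1 / 2) * (κ b - κ a) := by
  -- `κ x` is the same on both sides of `x`, so it drops out of interior jumps and survives only at
  -- `a` and `b`.
  have hat : ∀ x, indAt x N M = indAt x P Q + indAt x U V +
      (-(1 / 2)) * (sideSign 1 x S - sideSign (-1) x S) := by
    intro x
    simp only [indAt, indRight_eq_indSide, indLeft_eq_indSide]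
    rw [h x 1 (.inl rfl), h x (-1) (.inr rfl)]
    ring
  have hfin := finite_support_sideSign S
  have hsum : (∑ᶠ x ∈ Set.Ioo a b, indAt x N M) = (∑ᶠ x ∈ Set.Ioo a b, indAt x P Q) +
      (∑ᶠ x ∈ Set.Ioo a b, indAt x U V) +
      (-(1 / 2)) * ∑ᶠ x ∈ Set.Ioo a b, (sideSign 1 x S - sideSign (-1) x S) := by
    rw [← finsum_mem_add_distrib' ((finite_support_indAt P Q).subset Set.inter_subset_right)
      ((finite_support_indAt U V).subset Set.inter_subset_right),
      mul_finsum_mem,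
      ← finsum_mem_add_distrib']
    · exact finsum_mem_congr rfl fun x _ => hat x
    · refine (((finite_support_indAt P Q).union (finite_support_indAt U V)).subset ?_).subset
        Set.inter_subset_right
      exact Function.support_add _ _
    · exact hfin.subset fun x hx => right_ne_zero_of_mul hx.2
  have htel := sideSign_add_finsum_sub hab S
  simp only [ind, if_pos hab, indInc, hsum, indRight_eq_indSide, indLeft_eq_indSide]
  rw [h a 1 (.inl rfl), h b (-1) (.inr rfl)]
  linear_combination (-(1 / 2)) * htel

end Telescoping

/-! ### Leading values at a point -/

section LeadingCoefficient

variable {K : Type*} [Field K]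

/-- The value at `x` of the cofactor of the largest power of `X - x` that divides `f`. -/
def leadAt (x : K) (f : K[X]) : K := (f /ₘ (X - C x) ^ f.rootMultiplicity x).eval x

theorem leadAt_pow_mul (x : K) (m : ℕ) {A : K[X]} (hA : A.eval x ≠ 0) :
    leadAt x ((X - C x) ^ m * A) = A.eval x := by
  rw [leadAt, rootMultiplicity_pow_mul x m hA,
    mul_divByMonic_cancel_left _ ((monic_X_sub_C x).pow m)]

end LeadingCoefficient

/-! ### The addition formula on an interval -/

section ComplexIndex

variable {R : Type*} [Field R] [LinearOrder R] [IsStrictOrderedRing R]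

/-- The polynomial `P + iQ` over `R[i]`. -/
def cpoly (P Q : R[X]) : (Cplx R)[X] :=
  P.map (algebraMap R (Cplx R)) + C ⟨0, 1⟩ * Q.map (algebraMap R (Cplx R))

theorem eval_cpoly (P Q : R[X]) (x : R) :
    (cpoly P Q).eval (algebraMap R (Cplx R) x) = ⟨P.eval x, Q.eval x⟩ := by
  rw [cpoly, eval_add, eval_mul, eval_C, eval_map_algebraMap, eval_map_algebraMap,
    aeval_algebraMap_apply, aeval_algebraMap_apply]
  ext <;> simp

theorem cpoly_pow_mul (P Q : R[X]) (x : R) (m : ℕ) :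
    cpoly ((X - C x) ^ m * P) ((X - C x) ^ m * Q) =
      (X - C (algebraMap R (Cplx R) x)) ^ m * cpoly P Q := by
  simp only [cpoly, Polynomial.map_mul, Polynomial.map_pow, Polynomial.map_sub, map_X, map_C]
  ring

theorem leadAt_cpoly {P Q : R[X]} {x : R} (m : ℕ) (h : P.eval x ≠ 0 ∨ Q.eval x ≠ 0) :
    leadAt (algebraMap R (Cplx R) x) (cpoly ((X - C x) ^ m * P) ((X - C x) ^ m * Q)) =
      ⟨P.eval x, Q.eval x⟩ := by
  rw [cpoly_pow_mul, leadAt_pow_mul, eval_cpoly]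
  rw [eval_cpoly]
  intro h0
  have h1 := congrArg QuadraticAlgebra.re h0
  have h2 := congrArg QuadraticAlgebra.im h0
  simp at h1 h2
  tauto

omit [LinearOrder R] [IsStrictOrderedRing R] in
/-- Two polynomials can be divided by a common power of `X - x` so that `x` is not a common root
any more. -/
theorem exists_eq_pow_mul_pair (x : R) {P Q : R[X]} (h : P ≠ 0 ∨ Q ≠ 0) :
    ∃ m A B, P = (X - C x) ^ m * A ∧ Q = (X - C x) ^ m * B ∧ (A.eval x ≠ 0 ∨ B.eval x ≠ 0) := by
  have key : ∀ {P : R[X]}, P ≠ 0 → ∀ Q : R[X],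
      -- The zero polynomial has `rootMultiplicity` 0 although every power divides it, so only
      -- nonzero `Q` is compared.
      (Q ≠ 0 → P.rootMultiplicity x ≤ Q.rootMultiplicity x) →
      ∃ m A B, P = (X - C x) ^ m * A ∧ Q = (X - C x) ^ m * B ∧ A.eval x ≠ 0 := by
    intro P hP Q hQ
    obtain ⟨m, A, rfl, hA⟩ := exists_eq_pow_mul x hP
    rw [rootMultiplicity_pow_mul x m hA] at hQ
    have : (X - C x) ^ m ∣ Q := by
      rcases eq_or_ne Q 0 with rfl | hQ0
      · exact dvd_zero _
      · exact (le_rootMultiplicity_iff hQ0).1 (hQ hQ0)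
    obtain ⟨B, hB⟩ := this
    exact ⟨m, A, B, rfl, hB, hA⟩
  by_cases hc : P ≠ 0 ∧ (Q ≠ 0 → P.rootMultiplicity x ≤ Q.rootMultiplicity x)
  · obtain ⟨m, A, B, h1, h2, h3⟩ := key hc.1 Q hc.2
    exact ⟨m, A, B, h1, h2, .inl h3⟩
  · have hQ : Q ≠ 0 := by
      rintro rfl
      exact hc ⟨h.resolve_right (by simp), fun h => absurd rfl h⟩
    obtain ⟨m, A, B, h1, h2, h3⟩ := key hQ P (fun hP => by
      by_contra hlt
      exact hc ⟨hP, fun _ => (not_le.1 hlt).le⟩)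
    exact ⟨m, B, A, h2, h1, .inr h3⟩

theorem ne_zero_or_ne_zero_of_cpoly_ne_zero {P Q : R[X]} (h : cpoly P Q ≠ 0) :
    P ≠ 0 ∨ Q ≠ 0 := by
  by_contra! h0
  exact h (by simp [cpoly, h0])

theorem leadAt_cpoly_neg {P Q : R[X]} (h : cpoly P Q ≠ 0) (x : R) :
    leadAt (algebraMap R (Cplx R) x) (cpoly P (-Q)) =
      star (leadAt (algebraMap R (Cplx R) x) (cpoly P Q)) := by
  obtain ⟨m, A, B, rfl, rfl, hAB⟩ :=
    exists_eq_pow_mul_pair x (ne_zero_or_ne_zero_of_cpoly_ne_zero h)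
  rw [leadAt_cpoly m hAB, ← mul_neg, leadAt_cpoly m (by simpa using hAB)]
  ext <;> simp

/-- The correction term in the addition formula for the Cauchy index: twice the defect of
additivity of the index function of the argument of a nonzero element. -/
def argDefect (u v : Cplx R) : ℚ := sgn u.im * sgn v.im * sgn (u * v).im

/-- The three signs are multiplied by those of $r$, $s$ and $rs$, whose product is 1. Hence the
defect depends only on the real lines through `u` and `v`. -/
theorem argDefect_real_mul {r s : R} (hr : r ≠ 0) (hs : s ≠ 0) (u v : Cplx R) :
    argDefect (algebraMap R (Cplx R) r * u) (algebraMap R (Cplx R) s * v) = argDefect u v := by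
  have h1 : (algebraMap R (Cplx R) r * u).im = r * u.im := by simp
  have h2 : (algebraMap R (Cplx R) s * v).im = s * v.im := by simp
  have h3 : (algebraMap R (Cplx R) r * u * (algebraMap R (Cplx R) s * v)).im =
      r * s * (u * v).im := by
    simp; ring
  rw [argDefect, argDefect, h1, h2, h3, sgn_mul, sgn_mul, sgn_mul, sgn_mul]
  linear_combination (sgn u.im * sgn v.im * sgn (u * v).im) *
    (sgn s * sgn s * sgn_mul_self hr + sgn_mul_self hs)

theorem ind_neg_right {a b : R} (hab : a < b) (P Q : R[X]) :
    ind a b P (-Q) = -ind a b P Q := by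
  have h : ∀ x, indAt x P (-Q) = -indAt x P Q := fun x => by
    simp only [indAt, indRight_eq_indSide, indLeft_eq_indSide, indSide_neg_right]; ring
  simp only [ind, if_pos hab, indInc, indRight_eq_indSide, indLeft_eq_indSide,
    indSide_neg_right, h, finsum_neg_distrib]
  ring

theorem ind_mul_mul {a b : R} (hab : a < b) {S : R[X]} (hS : S ≠ 0) (P Q : R[X]) :
    ind a b (S * P) (S * Q) = ind a b P Q := by
  simp only [ind, if_pos hab, indInc, indAt, indRight_eq_indSide, indLeft_eq_indSide,
    indSide_mul_mul (.inl rfl) _ hS, indSide_mul_mul (.inr rfl) _ hS]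

/-- The addition formula for the Cauchy index of the product `(P + iQ)(U + iV)`. -/
theorem ind_mul [IsRealClosed R] {a b : R} (hab : a < b) {P Q U V : R[X]}
    (hf : cpoly P Q ≠ 0) (hg : cpoly U V ≠ 0) :
    ind a b (P * U - Q * V) (P * V + Q * U) = ind a b P Q + ind a b U V - (1 / 2) *
      (argDefect (leadAt (algebraMap R (Cplx R) b) (cpoly P Q))
          (leadAt (algebraMap R (Cplx R) b) (cpoly U V))
        - argDefect (leadAt (algebraMap R (Cplx R) a) (cpoly P Q))
          (leadAt (algebraMap R (Cplx R) a) (cpoly U V))) := by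
  refine ind_eq_add_of_indSide hab (Q * V * (P * V + Q * U)) (fun x => argDefect
    (leadAt (algebraMap R (Cplx R) x) (cpoly P Q))
    (leadAt (algebraMap R (Cplx R) x) (cpoly U V))) fun x ε hε => ?_
  obtain ⟨m, A, B, rfl, rfl, hAB⟩ :=
    exists_eq_pow_mul_pair x (ne_zero_or_ne_zero_of_cpoly_ne_zero hf)
  obtain ⟨n, D, E, rfl, rfl, hDE⟩ :=
    exists_eq_pow_mul_pair x (ne_zero_or_ne_zero_of_cpoly_ne_zero hg)
  rw [leadAt_cpoly m hAB, leadAt_cpoly n hDE]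
  have hm : (X - C x) ^ m ≠ 0 := pow_ne_zero _ (X_sub_C_ne_zero x)
  have hn : (X - C x) ^ n ≠ 0 := pow_ne_zero _ (X_sub_C_ne_zero x)
  have e1 : (X - C x) ^ m * A * ((X - C x) ^ n * D) - (X - C x) ^ m * B * ((X - C x) ^ n * E) =
    (X - C x) ^ m * (X - C x) ^ n * (A * D - B * E) := by ring
  have e2 : (X - C x) ^ m * A * ((X - C x) ^ n * E) + (X - C x) ^ m * B * ((X - C x) ^ n * D) =
    (X - C x) ^ m * (X - C x) ^ n * (A * E + B * D) := by ring
  rw [e1, e2, indSide_mul_mul hε x (mul_ne_zero hm hn), indSide_mul_mul hε x hm,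
    indSide_mul_mul hε x hn, indSide_mul hε x hAB hDE]
  simp only [sideSign_mul]
  have e3 : (⟨A.eval x, B.eval x⟩ * ⟨D.eval x, E.eval x⟩ : Cplx R).im =
    (A * E + B * D).eval x := by simp
  rw [argDefect, e3]
  have h1 := sideSign_mul_self hε x hm
  have h2 := sideSign_mul_self hε x hn
  set p := sideSign ε x ((X - C x) ^ m)
  set q := sideSign ε x ((X - C x) ^ n)
  -- The extracted powers enter `Q`, `V` and `P * V + Q * U` with signs `p`, `q` and `p * q`, so
  -- their total contribution is a square.
  linear_combination (1 / 2 * sideSign ε x B * sideSign ε x E * sideSign ε x (A * E + B * D)) *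
    (q * q * h1 + h2)

end ComplexIndex

/-! ### Real and imaginary parts of polynomials in two variables -/

section Parts

variable {R : Type*} [CommRing R]

theorem coeff_rePart (F : MvPolynomial (Fin 2) (Cplx R)) (m : Fin 2 →₀ ℕ) :
    (rePart F).coeff m = (F.coeff m).re := by
  classical
  simp only [rePart, MvPolynomial.coeff_sum, MvPolynomial.coeff_monomial, Finset.sum_ite_eq',
    MvPolynomial.mem_support_iff]
  split_ifs with h
  · rfl
  · simp [not_not.1 h]

theorem coeff_imPart (F : MvPolynomial (Fin 2) (Cplx R)) (m : Fin 2 →₀ ℕ) :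
    (imPart F).coeff m = (F.coeff m).im := by
  classical
  simp only [imPart, MvPolynomial.coeff_sum, MvPolynomial.coeff_monomial, Finset.sum_ite_eq',
    MvPolynomial.mem_support_iff]
  split_ifs with h
  · rfl
  · simp [not_not.1 h]

/-- The polynomial `P + iQ` over `R[i]`. -/
def ofParts (P Q : MvPolynomial (Fin 2) R) : MvPolynomial (Fin 2) (Cplx R) :=
  MvPolynomial.map (algebraMap R (Cplx R)) P +
    MvPolynomial.C ⟨0, 1⟩ * MvPolynomial.map (algebraMap R (Cplx R)) Q

theorem ofParts_rePart_imPart (F : MvPolynomial (Fin 2) (Cplx R)) :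
    ofParts (rePart F) (imPart F) = F := by
  ext m <;> simp [ofParts, MvPolynomial.coeff_map, coeff_rePart, coeff_imPart]

theorem rePart_ofParts (P Q : MvPolynomial (Fin 2) R) : rePart (ofParts P Q) = P := by
  ext m; simp [ofParts, MvPolynomial.coeff_map, coeff_rePart]

theorem imPart_ofParts (P Q : MvPolynomial (Fin 2) R) : imPart (ofParts P Q) = Q := by
  ext m; simp [ofParts, MvPolynomial.coeff_map, coeff_imPart]

theorem ofParts_mul (P Q U V : MvPolynomial (Fin 2) R) :
    ofParts P Q * ofParts U V = ofParts (P * U - Q * V) (P * V + Q * U) := by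
  have h : (MvPolynomial.C ⟨0, 1⟩ * MvPolynomial.C ⟨0, 1⟩ : MvPolynomial (Fin 2) (Cplx R)) = -1 := by
    rw [← MvPolynomial.C_mul, ← MvPolynomial.C_1, ← MvPolynomial.C_neg]
    congr 1
    ext <;> simp [QuadraticAlgebra.re_one, QuadraticAlgebra.im_one]
  simp only [ofParts, map_sub, map_add, map_mul]
  linear_combination (MvPolynomial.map (algebraMap R (Cplx R)) Q *
    MvPolynomial.map (algebraMap R (Cplx R)) V) * h

theorem rePart_mul (F G : MvPolynomial (Fin 2) (Cplx R)) :
    rePart (F * G) = rePart F * rePart G - imPart F * imPart G := by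
  conv_lhs => rw [← ofParts_rePart_imPart F, ← ofParts_rePart_imPart G, ofParts_mul,
    rePart_ofParts]

theorem imPart_mul (F G : MvPolynomial (Fin 2) (Cplx R)) :
    imPart (F * G) = rePart F * imPart G + imPart F * rePart G := by
  conv_lhs => rw [← ofParts_rePart_imPart F, ← ofParts_rePart_imPart G, ofParts_mul,
    imPart_ofParts]

theorem rePart_conjPoly (F : MvPolynomial (Fin 2) (Cplx R)) : rePart (conjPoly F) = rePart F := by
  ext m
  rw [coeff_rePart, coeff_rePart, conjPoly, MvPolynomial.coeff_map, starRingEnd_apply]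
  simp

theorem imPart_conjPoly (F : MvPolynomial (Fin 2) (Cplx R)) :
    imPart (conjPoly F) = -imPart F := by
  ext m
  rw [MvPolynomial.coeff_neg, coeff_imPart, coeff_imPart, conjPoly, MvPolynomial.coeff_map,
    starRingEnd_apply]
  simp

end Parts

/-! ### Restriction to lines and additivity of the winding number -/

section Restriction

variable {R : Type*} [Field R] [LinearOrder R] [IsStrictOrderedRing R]

/-- The restriction of a polynomial over `R[i]` to a curve with parametrization `γ`. -/
def restrict (γ : Fin 2 → R[X]) : MvPolynomial (Fin 2) (Cplx R) →ₐ[Cplx R] (Cplx R)[X] :=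
  MvPolynomial.aeval fun j => (γ j).map (algebraMap R (Cplx R))

theorem restrict_map (γ : Fin 2 → R[X]) (P : MvPolynomial (Fin 2) R) :
    restrict γ (MvPolynomial.map (algebraMap R (Cplx R)) P) =
      (MvPolynomial.aeval γ P).map (algebraMap R (Cplx R)) := by
  induction P using MvPolynomial.induction_on with
  | C a => simp [restrict]
  | add P Q hP hQ => simp only [map_add, Polynomial.map_add, hP, hQ]
  | mul_X P j hP => simp only [map_mul, Polynomial.map_mul, hP]; simp [restrict]

theorem restrict_eq_cpoly (γ : Fin 2 → R[X]) (F : MvPolynomial (Fin 2) (Cplx R)) :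
    restrict γ F = cpoly (MvPolynomial.aeval γ (rePart F)) (MvPolynomial.aeval γ (imPart F)) := by
  conv_lhs => rw [← ofParts_rePart_imPart F]
  rw [ofParts, map_add, map_mul, restrict_map, restrict_map, cpoly]
  simp [restrict]

/-- The Cauchy index of `F` along a curve with parametrization `γ`. -/
def curveInd (γ : Fin 2 → R[X]) (a b : R) (F : MvPolynomial (Fin 2) (Cplx R)) : ℚ :=
  ind a b (MvPolynomial.aeval γ (rePart F)) (MvPolynomial.aeval γ (imPart F))

/-- The direction of `F` at the parameter `t` of a curve with parametrization `γ`. -/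
def direction (γ : Fin 2 → R[X]) (t : R) (F : MvPolynomial (Fin 2) (Cplx R)) : Cplx R :=
  leadAt (algebraMap R (Cplx R) t) (restrict γ F)

theorem curveInd_mul [IsRealClosed R] (γ : Fin 2 → R[X]) {a b : R} (hab : a < b)
    {F G : MvPolynomial (Fin 2) (Cplx R)} (hF : restrict γ F ≠ 0) (hG : restrict γ G ≠ 0) :
    curveInd γ a b (F * G) = curveInd γ a b F + curveInd γ a b G - (1 / 2) *
      (argDefect (direction γ b F) (direction γ b G)
        - argDefect (direction γ a F) (direction γ a G)) := by
  rw [restrict_eq_cpoly] at hF hG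
  simp only [curveInd, direction, rePart_mul, imPart_mul, map_sub, map_add, map_mul,
    restrict_eq_cpoly]
  exact ind_mul hab hF hG

theorem curveInd_conjPoly (γ : Fin 2 → R[X]) {a b : R} (hab : a < b)
    (F : MvPolynomial (Fin 2) (Cplx R)) :
    curveInd γ a b (conjPoly F) = -curveInd γ a b F := by
  rw [curveInd, rePart_conjPoly, imPart_conjPoly, map_neg, ind_neg_right hab, curveInd]

theorem direction_conjPoly {γ : Fin 2 → R[X]} {F : MvPolynomial (Fin 2) (Cplx R)}
    (hF : restrict γ F ≠ 0) (t : R) : direction γ t (conjPoly F) = star (direction γ t F) := by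
  rw [restrict_eq_cpoly] at hF
  rw [direction, direction, restrict_eq_cpoly, restrict_eq_cpoly, rePart_conjPoly,
    imPart_conjPoly, map_neg, leadAt_cpoly_neg hF]

theorem restrict_conjPoly_ne_zero {γ : Fin 2 → R[X]} {F : MvPolynomial (Fin 2) (Cplx R)}
    (hF : restrict γ F ≠ 0) : restrict γ (conjPoly F) ≠ 0 := by
  rw [restrict_eq_cpoly] at hF ⊢
  rw [rePart_conjPoly, imPart_conjPoly, map_neg]
  have hI : (⟨0, 1⟩ : Cplx R) ≠ 0 := fun h => by simpa using congrArg QuadraticAlgebra.im h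
  set P := MvPolynomial.aeval γ (rePart F)
  set Q := MvPolynomial.aeval γ (imPart F)
  intro h
  apply hF
  have h1 : ∀ n, (cpoly P (-Q)).coeff n = ⟨P.coeff n, -Q.coeff n⟩ := fun n => by
    ext <;> simp [cpoly]
  have h2 : ∀ n, (cpoly P Q).coeff n = ⟨P.coeff n, Q.coeff n⟩ := fun n => by
    ext <;> simp [cpoly]
  ext n
  · have := congrArg QuadraticAlgebra.re ((h1 n).symm.trans (by rw [h]))
    simpa [h2] using this
  · have := congrArg QuadraticAlgebra.im ((h1 n).symm.trans (by rw [h]))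
    simpa [h2] using this

/-- Multiplication by a nonzero real polynomial does not change the index along a curve. -/
theorem curveInd_mul_conjPoly_mul (γ : Fin 2 → R[X]) {a b : R} (hab : a < b)
    {F G : MvPolynomial (Fin 2) (Cplx R)} (hG : restrict γ G ≠ 0) :
    curveInd γ a b (G * conjPoly G * F) = curveInd γ a b F := by
  have h0 : restrict γ (G * conjPoly G) ≠ 0 := by
    rw [map_mul]; exact mul_ne_zero hG (restrict_conjPoly_ne_zero hG)
  have him : imPart (G * conjPoly G) = 0 := by
    rw [imPart_mul, rePart_conjPoly, imPart_conjPoly]; ring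
  have hre : MvPolynomial.aeval γ (rePart (G * conjPoly G)) ≠ 0 := by
    intro h
    rw [restrict_eq_cpoly, him, h] at h0
    simp [cpoly] at h0
  rw [curveInd, rePart_mul _ F, imPart_mul _ F, him, zero_mul, zero_mul, sub_zero, add_zero,
    map_mul, map_mul, ind_mul_mul hab hre, curveInd]

/-- The horizontal line at height `y`. -/
def horiz (y : R) : Fin 2 → R[X] := ![X, C y]

/-- The vertical line with abscissa `x`. -/
def vert (x : R) : Fin 2 → R[X] := ![C x, X]

omit [IsStrictOrderedRing R] in
theorem winding_eq {x₀ x₁ y₀ y₁ : R} (hx : x₀ < x₁) (hy : y₀ < y₁)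
    (F : MvPolynomial (Fin 2) (Cplx R)) :
    winding F x₀ x₁ y₀ y₁ = (1 / 2) * (curveInd (horiz y₀) x₀ x₁ F + curveInd (vert x₁) y₀ y₁ F
      - curveInd (horiz y₁) x₀ x₁ F - curveInd (vert x₀) y₀ y₁ F) := by
  have hswap : ∀ {a b : R}, a < b → ∀ P Q, ind b a P Q = -ind a b P Q := by
    intro a b hab P Q
    rw [ind, ind, if_neg hab.not_gt, if_pos hab, if_pos hab]
  rw [winding, hswap hx, hswap hy]
  simp only [curveInd, horiz, vert, restrictHoriz, restrictVert]
  ring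

/-- The restrictions of `F` to horizontal and vertical lines are nonzero. -/
def NonzeroOnLines (F : MvPolynomial (Fin 2) (Cplx R)) : Prop :=
  (∀ y : R, restrict (horiz y) F ≠ 0) ∧ ∀ x : R, restrict (vert x) F ≠ 0

/-- The corrections to the additivity of the index for `F * G` along the horizontal and along the
vertical line through `z` agree. -/
def CornersAgree (z : Cplx R) (F G : MvPolynomial (Fin 2) (Cplx R)) : Prop :=
  argDefect (direction (horiz z.im) z.re F) (direction (horiz z.im) z.re G) =
    argDefect (direction (vert z.re) z.im F) (direction (vert z.re) z.im G)

/-- Every edge brings in a correction at each of its ends. The two corrections at a vertex have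
opposite signs in the oriented sum, so they cancel when they agree. -/
theorem winding_mul [IsRealClosed R] {x₀ x₁ y₀ y₁ : R} (hx : x₀ < x₁) (hy : y₀ < y₁)
    {F G : MvPolynomial (Fin 2) (Cplx R)} (hF : NonzeroOnLines F) (hG : NonzeroOnLines G)
    (h : ∀ z ∈ vertices x₀ x₁ y₀ y₁, CornersAgree z F G) :
    winding (F * G) x₀ x₁ y₀ y₁ = winding F x₀ x₁ y₀ y₁ + winding G x₀ x₁ y₀ y₁ := by
  simp only [vertices, Set.mem_insert_iff, Set.mem_singleton_iff, forall_eq_or_imp, forall_eq,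
    CornersAgree] at h
  obtain ⟨h1, h2, h3, h4⟩ := h
  simp only [winding_eq hx hy, curveInd_mul _ hx (hF.1 _) (hG.1 _),
    curveInd_mul _ hy (hF.2 _) (hG.2 _)]
  linear_combination (1 / 4) * (h1 - h2 + h3 - h4)

theorem winding_conjPoly {x₀ x₁ y₀ y₁ : R} (hx : x₀ < x₁) (hy : y₀ < y₁)
    (F : MvPolynomial (Fin 2) (Cplx R)) :
    winding (conjPoly F) x₀ x₁ y₀ y₁ = -winding F x₀ x₁ y₀ y₁ := by
  simp only [winding_eq hx hy, curveInd_conjPoly _ hx, curveInd_conjPoly _ hy]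
  ring

theorem winding_mul_conjPoly_mul {x₀ x₁ y₀ y₁ : R} (hx : x₀ < x₁) (hy : y₀ < y₁)
    {F G : MvPolynomial (Fin 2) (Cplx R)} (hG : NonzeroOnLines G) :
    winding (G * conjPoly G * F) x₀ x₁ y₀ y₁ = winding F x₀ x₁ y₀ y₁ := by
  simp only [winding_eq hx hy, curveInd_mul_conjPoly_mul _ hx (hG.1 _),
    curveInd_mul_conjPoly_mul _ hy (hG.2 _)]

end Restriction

/-! ### Polynomials in $Z$: directions at a vertex -/

section Holomorphic

variable {R : Type*} [Field R] [LinearOrder R] [IsStrictOrderedRing R]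

theorem restrict_incl (γ : Fin 2 → R[X]) (p : (Cplx R)[X]) :
    restrict γ (incl p) = p.comp (cpoly (γ 0) (γ 1)) := by
  rw [incl, ← Polynomial.aeval_algHom_apply, comp_eq_aeval]
  congr 1
  simp [restrict, cpoly]

/-- Both lines through `z` have the form $z+\rho(T-t)$, with $\rho=1$ here and $\rho=i$ in
`cpoly_vert`; the factor `C 1` keeps this common shape for `leadAt_comp`. -/
theorem cpoly_horiz (z : Cplx R) : cpoly (horiz z.im 0) (horiz z.im 1) =
    C z + C 1 * (X - C (algebraMap R (Cplx R) z.re)) := by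
  have h : C z = C (algebraMap R (Cplx R) z.re) +
      C (⟨0, 1⟩ : Cplx R) * C (algebraMap R (Cplx R) z.im) := by
    rw [← C_mul, ← C_add]; congr 1; ext <;> simp
  simp only [h, cpoly, horiz, Matrix.cons_val_zero, Matrix.cons_val_one, map_X, map_C, C_1]
  ring

theorem cpoly_vert (z : Cplx R) : cpoly (vert z.re 0) (vert z.re 1) =
    C z + C ⟨0, 1⟩ * (X - C (algebraMap R (Cplx R) z.im)) := by
  have h : C z = C (algebraMap R (Cplx R) z.re) +
      C (⟨0, 1⟩ : Cplx R) * C (algebraMap R (Cplx R) z.im) := by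
    rw [← C_mul, ← C_add]; congr 1; ext <;> simp
  simp only [h, cpoly, vert, Matrix.cons_val_zero, Matrix.cons_val_one, map_X, map_C]
  ring

theorem cplx_I_ne_zero : (⟨0, 1⟩ : Cplx R) ≠ 0 := fun h => by
  simpa using congrArg QuadraticAlgebra.im h

theorem nonzeroOnLines_incl {p : (Cplx R)[X]} (hp : p ≠ 0) : NonzeroOnLines (incl p) := by
  have key : ∀ z ρ t : Cplx R, ρ ≠ 0 → p.comp (C z + C ρ * (X - C t)) ≠ 0 := by
    intro z ρ t hρ h
    rcases comp_eq_zero_iff.1 h with h | ⟨-, h⟩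
    · exact hp h
    · have := congrArg (fun q => coeff q 1) h
      simp [coeff_C, hρ] at this
  constructor
  · intro y
    rw [restrict_incl, cpoly_horiz ⟨0, y⟩]
    exact key _ _ _ one_ne_zero
  · intro x
    rw [restrict_incl, cpoly_vert ⟨x, 0⟩]
    exact key _ _ _ cplx_I_ne_zero

/-- The substitution turns $(Z-z)^m$ into $\rho^m(T-t)^m$. -/
theorem leadAt_comp {z ρ t : Cplx R} (hρ : ρ ≠ 0) (m : ℕ) {H : (Cplx R)[X]} (hH : H.eval z ≠ 0) :
    leadAt t (((X - C z) ^ m * H).comp (C z + C ρ * (X - C t))) = ρ ^ m * H.eval z := by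
  have h1 : ((X - C z) ^ m * H).comp (C z + C ρ * (X - C t)) =
      (X - C t) ^ m * (C (ρ ^ m) * H.comp (C z + C ρ * (X - C t))) := by
    simp only [mul_comp, pow_comp, sub_comp, X_comp, C_comp, C_pow]
    rw [add_sub_cancel_left, mul_pow]
    ring
  have h2 : (C (ρ ^ m) * H.comp (C z + C ρ * (X - C t))).eval t = ρ ^ m * H.eval z := by
    simp [eval_comp]
  rw [h1, leadAt_pow_mul t m (by rw [h2]; exact mul_ne_zero (pow_ne_zero _ hρ) hH), h2]

theorem direction_horiz_incl (z : Cplx R) (m : ℕ) {H : (Cplx R)[X]} (hH : H.eval z ≠ 0) :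
    direction (horiz z.im) z.re (incl ((X - C z) ^ m * H)) = H.eval z := by
  rw [direction, restrict_incl, cpoly_horiz, leadAt_comp one_ne_zero m hH, one_pow, one_mul]

theorem direction_vert_incl (z : Cplx R) (m : ℕ) {H : (Cplx R)[X]} (hH : H.eval z ≠ 0) :
    direction (vert z.re) z.im (incl ((X - C z) ^ m * H)) = ⟨0, 1⟩ ^ m * H.eval z := by
  rw [direction, restrict_incl, cpoly_vert, leadAt_comp cplx_I_ne_zero m hH]

/-- The directions of `F` along the horizontal and along the vertical line through `z` agree up
to a real factor. -/
def SameDirection (z : Cplx R) (F : MvPolynomial (Fin 2) (Cplx R)) : Prop :=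
  ∃ r : R, r ≠ 0 ∧ direction (horiz z.im) z.re F =
    algebraMap R (Cplx R) r * direction (vert z.re) z.im F

theorem SameDirection.cornersAgree {z : Cplx R} {F G : MvPolynomial (Fin 2) (Cplx R)}
    (hF : SameDirection z F) (hG : SameDirection z G) : CornersAgree z F G := by
  obtain ⟨r, hr, hF⟩ := hF
  obtain ⟨s, hs, hG⟩ := hG
  rw [CornersAgree, hF, hG, argDefect_real_mul hr hs]

theorem SameDirection.conjPoly {z : Cplx R} {F : MvPolynomial (Fin 2) (Cplx R)}
    (hF : NonzeroOnLines F) (h : SameDirection z F) : SameDirection z (conjPoly F) := by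
  obtain ⟨r, hr, h⟩ := h
  refine ⟨r, hr, ?_⟩
  rw [direction_conjPoly (hF.1 _), direction_conjPoly (hF.2 _), h, star_mul']
  congr 1
  ext <;> simp

/-- The directions differ by $i^m$, which for $m=2k$ is the real number $(-1)^k$. This is where
evenness at the vertices matters. -/
theorem sameDirection_incl {z : Cplx R} {p : (Cplx R)[X]} (hp : p ≠ 0)
    (h : Even (p.rootMultiplicity z)) : SameDirection z (incl p) := by
  obtain ⟨m, H, rfl, hH⟩ := exists_eq_pow_mul z hp
  rw [rootMultiplicity_pow_mul z m hH] at h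
  obtain ⟨k, rfl⟩ := h
  refine ⟨(-1) ^ k, pow_ne_zero _ (by norm_num), ?_⟩
  have hI : (⟨0, 1⟩ * ⟨0, 1⟩ : Cplx R) = -1 := by
    ext <;> simp [QuadraticAlgebra.re_one, QuadraticAlgebra.im_one]
  rw [direction_horiz_incl z _ hH, direction_vert_incl z _ hH, pow_add, ← mul_pow, hI, map_pow,
    map_neg, map_one, ← mul_assoc, ← mul_pow]
  norm_num

/-- The correction vanishes for the square of a linear polynomial. -/
theorem cornersAgree_X_sub_C (z v : Cplx R) : CornersAgree z (incl (X - C v)) (incl (X - C v)) := by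
  by_cases hz : z = v
  · subst hz
    have h : X - C z = (X - C z) ^ 1 * 1 := by simp
    have h1 : (1 : (Cplx R)[X]).eval z ≠ 0 := by simp
    -- The directions are $1$ and $i$. Both squares are real, so both defects are zero.
    rw [CornersAgree, h, direction_horiz_incl z 1 h1, direction_vert_incl z 1 h1]
    simp [argDefect, QuadraticAlgebra.im_one]
  · have h := sameDirection_incl (z := z) (X_sub_C_ne_zero v) (by
      rw [rootMultiplicity_eq_zero (by simpa using sub_ne_zero.2 hz)]; exact Even.zero)
    exact h.cornersAgree h

/-! ### Winding numbers of constants and linear factors -/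

omit [LinearOrder R] [IsStrictOrderedRing R] in
theorem incl_C (c : Cplx R) : incl (C c) = ofParts (MvPolynomial.C c.re) (MvPolynomial.C c.im) := by
  have h : c = algebraMap R (Cplx R) c.re + ⟨0, 1⟩ * algebraMap R (Cplx R) c.im := by
    ext <;> simp
  rw [incl, aeval_C, ofParts, MvPolynomial.map_C, MvPolynomial.map_C, ← MvPolynomial.C_mul,
    ← MvPolynomial.C_add, ← h]
  rfl

theorem incl_X_sub_C (a : Cplx R) : incl (X - C a) =
    ofParts (MvPolynomial.X 0 - MvPolynomial.C a.re) (MvPolynomial.X 1 - MvPolynomial.C a.im) := by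
  have h : incl (X - C a) = incl X - incl (C a) := by simp [incl]
  rw [h, incl_C]
  simp only [incl, ofParts, aeval_X, map_sub, MvPolynomial.map_X]
  ring

theorem ind_const_right (a b : R) (P : R[X]) (c : R) : ind a b P (C c) = 0 := by
  have h : ∀ ε x, indSide ε x P (C c) = 0 := fun ε x => by
    rw [indSide, if_neg]
    rw [val, rootMultiplicity_C]
    omega
  simp [ind, indInc, indAt, indRight_eq_indSide, indLeft_eq_indSide, h]

/-- The only jump is at `d`, and each side of it carries half; at an endpoint only one side counts.
-/
theorem ind_const_linear {a b : R} (hab : a < b) (c d : R) : ind a b (C c) (X - C d) =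
    sgn c * (if d ∈ Set.Ioo a b then 1 else if d = a ∨ d = b then 1 / 2 else 0) := by
  have h : ∀ ε x, indSide ε x (C c) (X - C d) = if x = d then (1 / 2) * (sgn c * ε) else 0 := by
    intro ε x
    rcases eq_or_ne c 0 with rfl | hc
    · simp [indSide]
    rw [indSide_of_not_common_root ε x (by simp [hc])]
    by_cases hx : x = d
    · subst hx
      have h1 := sideSign_pow_mul ε x 1 (A := 1) (by simp)
      rw [pow_one, mul_one, eval_one, sgn_of_pos one_pos, pow_one, mul_one] at h1
      simp [h1]
    · simp [hx, sub_ne_zero.2 hx]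
  have hat : ∀ x, indAt x (C c) (X - C d) = if x = d then sgn c else 0 := fun x => by
    rw [indAt, indRight_eq_indSide, indLeft_eq_indSide, h, h]
    split_ifs <;> ring
  have hsum : (∑ᶠ x ∈ Set.Ioo a b, indAt x (C c) (X - C d)) =
      if d ∈ Set.Ioo a b then sgn c else 0 := by
    rw [finsum_eq_single _ d]
    · rw [hat, if_pos rfl]
      exact finsum_eq_if
    · intro x hx
      simp [hat, hx]
  rw [ind, if_pos hab, indInc, hsum, indRight_eq_indSide, indLeft_eq_indSide, h, h]
  by_cases hd : d ∈ Set.Ioo a b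
  · rw [if_neg hd.1.ne, if_neg hd.2.ne', if_pos hd, if_pos hd]; ring
  · rw [if_neg hd, if_neg hd]
    by_cases ha : d = a
    · subst ha
      rw [if_pos rfl, if_neg hab.ne', if_pos (.inl rfl)]; ring
    · rw [if_neg (Ne.symm ha)]
      by_cases hb : d = b
      · subst hb
        rw [if_pos rfl, if_pos (.inr rfl)]; ring
      · rw [if_neg (Ne.symm hb), if_neg (by tauto)]; ring

/-- The weight of a point in the count of zeros in a rectangle. -/
def weight (x₀ x₁ y₀ y₁ : R) (z : Cplx R) : ℚ :=
  (inside x₀ x₁ y₀ y₁).indicator 1 z + (1 / 2) * (edges x₀ x₁ y₀ y₁).indicator 1 z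
    + (1 / 4) * (vertices x₀ x₁ y₀ y₁).indicator 1 z

theorem winding_incl_C {x₀ x₁ y₀ y₁ : R} (hx : x₀ < x₁) (hy : y₀ < y₁) (c : Cplx R) :
    winding (incl (C c)) x₀ x₁ y₀ y₁ = 0 := by
  rw [winding_eq hx hy, incl_C]
  simp only [curveInd, rePart_ofParts, imPart_ofParts, MvPolynomial.aeval_C,
    Polynomial.algebraMap_eq, ind_const_right, ind_const_right]
  norm_num

/-- The imaginary part is constant on horizontal edges, so only vertical edges count. The result is
a product of a factor for each coordinate of `a`: 1 strictly inside its interval, 1/2 at an end, 0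
outside. -/
theorem winding_incl_X_sub_C {x₀ x₁ y₀ y₁ : R} (hx : x₀ < x₁) (hy : y₀ < y₁) (a : Cplx R) :
    winding (incl (X - C a)) x₀ x₁ y₀ y₁ = weight x₀ x₁ y₀ y₁ a := by
  have hh : ∀ y, curveInd (horiz y) x₀ x₁ (incl (X - C a)) = 0 := fun y => by
    rw [incl_X_sub_C, curveInd, rePart_ofParts, imPart_ofParts]
    have : MvPolynomial.aeval (horiz y) (MvPolynomial.X 1 - MvPolynomial.C a.im) =
      C (y - a.im) := by simp [horiz]
    rw [this, ind_const_right]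
  have hv : ∀ x, curveInd (vert x) y₀ y₁ (incl (X - C a)) = sgn (x - a.re) *
      (if a.im ∈ Set.Ioo y₀ y₁ then 1 else if a.im = y₀ ∨ a.im = y₁ then 1 / 2 else 0) :=
    fun x => by
      rw [incl_X_sub_C, curveInd, rePart_ofParts, imPart_ofParts, ← ind_const_linear hy]
      simp [vert]
  rw [winding_eq hx hy, hh, hh, hv, hv]
  obtain ⟨u, v⟩ := a
  have e : ∀ p q : R, ((⟨u, v⟩ : Cplx R) = ⟨p, q⟩) ↔ u = p ∧ v = q := fun p q => by
    rw [QuadraticAlgebra.ext_iff]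
  simp only [weight, inside, edges, vertices, Set.indicator_apply, Set.mem_ofPred_eq,
    Set.mem_insert_iff, Set.mem_singleton_iff, e, Pi.one_apply, Set.mem_Ioo]
  have hu : (sgn (x₀ - u) = 1 ∧ sgn (x₁ - u) = 1 ∧ ¬ x₀ < u ∧ u < x₁ ∧ u ≠ x₀ ∧ u ≠ x₁) ∨
      (sgn (x₀ - u) = 0 ∧ sgn (x₁ - u) = 1 ∧ ¬ x₀ < u ∧ u < x₁ ∧ u = x₀ ∧ x₀ ≠ x₁) ∨
      (sgn (x₀ - u) = -1 ∧ sgn (x₁ - u) = 1 ∧ x₀ < u ∧ u < x₁ ∧ u ≠ x₀ ∧ u ≠ x₁) ∨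
      (sgn (x₀ - u) = -1 ∧ sgn (x₁ - u) = 0 ∧ x₀ < u ∧ ¬ u < x₁ ∧ x₁ ≠ x₀ ∧ u = x₁) ∨
      (sgn (x₀ - u) = -1 ∧ sgn (x₁ - u) = -1 ∧ x₀ < u ∧ ¬ u < x₁ ∧ u ≠ x₀ ∧ u ≠ x₁) := by
    rcases lt_trichotomy u x₀ with h | h | h
    · exact .inl ⟨sgn_of_pos (by linarith), sgn_of_pos (by linarith), h.not_gt, h.trans hx, h.ne,
        (h.trans hx).ne⟩
    · exact .inr (.inl ⟨by simp [h], sgn_of_pos (by linarith), h.not_gt, h ▸ hx, h, hx.ne⟩)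
    rcases lt_trichotomy u x₁ with h' | h' | h'
    · exact .inr (.inr (.inl
        ⟨sgn_of_neg (by linarith), sgn_of_pos (by linarith), h, h', h.ne', h'.ne⟩))
    · exact .inr (.inr (.inr (.inl
        ⟨sgn_of_neg (by linarith), by simp [h'], h, h'.not_lt, hx.ne', h'⟩)))
    · exact .inr (.inr (.inr (.inr
        ⟨sgn_of_neg (by linarith), sgn_of_neg (by linarith), h, h'.not_gt, h.ne', h'.ne'⟩)))
  have hv : (¬ y₀ < v ∧ v ≠ y₀ ∧ v ≠ y₁) ∨ (¬ y₀ < v ∧ v = y₀ ∧ y₀ ≠ y₁) ∨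
      (y₀ < v ∧ v < y₁ ∧ v ≠ y₀ ∧ v ≠ y₁) ∨ (¬ v < y₁ ∧ y₁ ≠ y₀ ∧ v = y₁) ∨
      (¬ v < y₁ ∧ v ≠ y₀ ∧ v ≠ y₁) := by
    rcases lt_trichotomy v y₀ with h | h | h
    · exact .inl ⟨h.not_gt, h.ne, (h.trans hy).ne⟩
    · exact .inr (.inl ⟨h.not_gt, h, hy.ne⟩)
    rcases lt_trichotomy v y₁ with h' | h' | h'
    · exact .inr (.inr (.inl ⟨h, h', h.ne', h'.ne⟩))
    · exact .inr (.inr (.inr (.inl ⟨h'.not_lt, hy.ne', h'⟩)))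
    · exact .inr (.inr (.inr (.inr ⟨h'.not_gt, h.ne', h'.ne'⟩)))
  clear hh e
  rcases hu with ⟨h1, h2, hu⟩ | ⟨h1, h2, hu⟩ | ⟨h1, h2, hu⟩ | ⟨h1, h2, hu⟩ | ⟨h1, h2, hu⟩ <;>
    rw [h1, h2] <;> clear h1 h2 <;>
    rcases hv with hv | hv | hv | hv | hv <;> simp [hu, hv] <;> norm_num

/-- The winding number of a polynomial with even multiplicity at the vertices is the weighted
number of its roots. -/
theorem winding_incl [IsRealClosed R] {x₀ x₁ y₀ y₁ : R} (hx : x₀ < x₁) (hy : y₀ < y₁)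
    {p : (Cplx R)[X]} (hp : p ≠ 0)
    (heven : ∀ z ∈ vertices x₀ x₁ y₀ y₁, Even (p.rootMultiplicity z)) :
    winding (incl p) x₀ x₁ y₀ y₁ = (p.roots.map (weight x₀ x₁ y₀ y₁)).sum := by
  have hmul : ∀ p q : (Cplx R)[X], incl (p * q) = incl p * incl q := fun p q => by
    simp [incl]
  induction hn : p.natDegree using Nat.strong_induction_on generalizing p with
  | _ n ih =>
    by_cases h0 : p.natDegree = 0
    · rw [eq_C_of_natDegree_eq_zero h0, winding_incl_C hx hy, roots_C]; simp
    -- Removing one factor with root off the vertices preserves evenness there. If all roots are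
    -- vertices, a factor must be removed twice.
    by_cases hr : ∃ a, p.IsRoot a ∧ a ∉ vertices x₀ x₁ y₀ y₁
    · obtain ⟨a, hroot, ha⟩ := hr
      obtain ⟨q, rfl⟩ := dvd_iff_isRoot.2 hroot
      have hq := right_ne_zero_of_mul hp
      have hl : ∀ z ∈ vertices x₀ x₁ y₀ y₁, rootMultiplicity z (X - C a) = 0 := fun z hz =>
        rootMultiplicity_eq_zero (by
          simpa using sub_ne_zero.2 (fun h : z = a => ha (h ▸ hz)))
      have heq : ∀ z ∈ vertices x₀ x₁ y₀ y₁, Even (q.rootMultiplicity z) := fun z hz => by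
        simpa [rootMultiplicity_mul hp, hl z hz] using heven z hz
      rw [hmul, winding_mul hx hy (nonzeroOnLines_incl (X_sub_C_ne_zero a))
        (nonzeroOnLines_incl hq), winding_incl_X_sub_C hx hy, ih _ _ hq heq rfl, roots_mul hp,
        roots_X_sub_C, Multiset.map_add, Multiset.sum_add]
      · simp
      · rw [← hn, natDegree_mul (X_sub_C_ne_zero a) hq, natDegree_X_sub_C]; omega
      · exact fun z hz => (sameDirection_incl (X_sub_C_ne_zero a)
          (by rw [hl z hz]; exact Even.zero)).cornersAgree (sameDirection_incl hq (heq z hz))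
    · push Not at hr
      obtain ⟨v, hroot⟩ := IsAlgClosed.exists_root p
        (fun h => h0 (natDegree_eq_of_degree_eq_some h))
      have hm := heven v (hr v hroot)
      have hpos := (rootMultiplicity_pos hp).2 hroot
      have h2 : 2 ≤ p.rootMultiplicity v := by
        obtain ⟨k, hk⟩ := hm
        omega
      obtain ⟨q, rfl⟩ := (le_rootMultiplicity_iff hp).1 h2
      have hq := right_ne_zero_of_mul hp
      have hs : (X - C v) ^ 2 ≠ 0 := left_ne_zero_of_mul hp
      have hl : ∀ z, Even (((X - C v) ^ 2).rootMultiplicity z) := fun z => by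
        rw [sq, rootMultiplicity_mul (by rwa [← sq])]
        exact Even.add_self _
      have heq : ∀ z ∈ vertices x₀ x₁ y₀ y₁, Even (q.rootMultiplicity z) := fun z hz => by
        have := heven z hz
        rw [rootMultiplicity_mul hp, Nat.even_add] at this
        exact this.1 (hl z)
      rw [hmul, winding_mul hx hy (nonzeroOnLines_incl hs) (nonzeroOnLines_incl hq),
        ih _ _ hq heq rfl, roots_mul hp, roots_pow, roots_X_sub_C, Multiset.map_add,
        Multiset.sum_add, sq, hmul, winding_mul hx hy (nonzeroOnLines_incl (X_sub_C_ne_zero v))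
        (nonzeroOnLines_incl (X_sub_C_ne_zero v)), winding_incl_X_sub_C hx hy]
      · simp [two_nsmul]
      · exact fun z _ => cornersAgree_X_sub_C z v
      · rw [← hn, natDegree_mul hs hq, natDegree_pow, natDegree_X_sub_C]; omega
      · exact fun z hz =>
          (sameDirection_incl hs (hl z)).cornersAgree (sameDirection_incl hq (heq z hz))

/-! ### Counting zeros and poles -/

omit [LinearOrder R] [IsStrictOrderedRing R] in
theorem sum_map_roots_indicator {K : Type*} [Field K] (p : K[X]) (S : Set K) :
    (p.roots.map (S.indicator (1 : K → ℚ))).sum =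
      ((∑ᶠ z ∈ S, p.rootMultiplicity z : ℕ) : ℚ) := by
  classical
  rw [Finset.sum_multiset_map_count, finsum_mem_def, finsum_eq_sum_of_support_subset
    (s := p.roots.toFinset)]
  · rw [Nat.cast_sum]
    refine Finset.sum_congr rfl fun z _ => ?_
    by_cases hz : z ∈ S <;> simp [hz]
  · intro z hz
    rw [Finset.mem_coe, Multiset.mem_toFinset, ← Multiset.one_le_count_iff_mem, count_roots]
    by_contra! h
    apply hz
    rw [Set.indicator_apply]
    split_ifs <;> omega

theorem sum_map_roots_weight (x₀ x₁ y₀ y₁ : R) (p : (Cplx R)[X]) :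
    (p.roots.map (weight x₀ x₁ y₀ y₁)).sum =
      ((∑ᶠ z ∈ inside x₀ x₁ y₀ y₁, p.rootMultiplicity z : ℕ) : ℚ)
      + (1 / 2) * ((∑ᶠ z ∈ edges x₀ x₁ y₀ y₁, p.rootMultiplicity z : ℕ) : ℚ)
      + (1 / 4) * ((∑ᶠ z ∈ vertices x₀ x₁ y₀ y₁, p.rootMultiplicity z : ℕ) : ℚ) := by
  simp only [← sum_map_roots_indicator, ← Multiset.sum_map_mul_left, ← Multiset.sum_map_add]
  rfl

/-- Because of this, the truncations in `zerosIn` and `polesIn` return the multiplicities in the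
numerator and the denominator, and an even valuation makes both even. -/
theorem rootMultiplicity_num_or_denom (φ : RatFunc (Cplx R)) (z : Cplx R) :
    φ.num.rootMultiplicity z = 0 ∨ φ.denom.rootMultiplicity z = 0 := by
  by_contra! h
  have h1 := (rootMultiplicity_pos'.1 (Nat.pos_of_ne_zero h.1)).2
  have h2 := (rootMultiplicity_pos'.1 (Nat.pos_of_ne_zero h.2)).2
  obtain ⟨a, b, hab⟩ := RatFunc.isCoprime_num_denom φ
  have := congrArg (eval z) hab
  simp [h1.eq_zero, h2.eq_zero] at this

theorem zerosIn_eq (φ : RatFunc (Cplx R)) (S : Set (Cplx R)) :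
    zerosIn φ S = ∑ᶠ z ∈ S, φ.num.rootMultiplicity z :=
  finsum_mem_congr rfl fun z _ => by
    rcases rootMultiplicity_num_or_denom φ z with h | h <;> simp [ratVal, h]

theorem polesIn_eq (φ : RatFunc (Cplx R)) (S : Set (Cplx R)) :
    polesIn φ S = ∑ᶠ z ∈ S, φ.denom.rootMultiplicity z :=
  finsum_mem_congr rfl fun z _ => by
    rcases rootMultiplicity_num_or_denom φ z with h | h <;> simp [ratVal, h]

theorem even_rootMultiplicity_of_even_ratVal {φ : RatFunc (Cplx R)} {z : Cplx R}
    (h : Even (ratVal z φ)) :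
    Even (φ.num.rootMultiplicity z) ∧ Even (φ.denom.rootMultiplicity z) := by
  rcases rootMultiplicity_num_or_denom φ z with h0 | h0 <;>
    simpa [ratVal, h0, Int.even_coe_nat] using h

end Holomorphic

end AlgWinding

end

theorem theorem1p4 {R : Type*} [Field R] [LinearOrder R] [IsStrictOrderedRing R] [IsRealClosed R]
    (x₀ x₁ y₀ y₁ : R) (hx : x₀ < x₁) (hy : y₀ < y₁)
    (φ : RatFunc (AlgWinding.Cplx R)) (hφ : φ ≠ 0)
    (F G : Polynomial (AlgWinding.Cplx R)) (hG : G ≠ 0)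
    (hFG : φ = algebraMap (Polynomial (AlgWinding.Cplx R)) (RatFunc (AlgWinding.Cplx R)) F /
      algebraMap (Polynomial (AlgWinding.Cplx R)) (RatFunc (AlgWinding.Cplx R)) G)
    (heven : ∀ z ∈ AlgWinding.vertices x₀ x₁ y₀ y₁, Even (AlgWinding.ratVal z φ)) :
    AlgWinding.windingFrac (AlgWinding.incl F) (AlgWinding.incl G) x₀ x₁ y₀ y₁ =
      ((AlgWinding.zerosIn φ (AlgWinding.inside x₀ x₁ y₀ y₁) : ℚ)
        - AlgWinding.polesIn φ (AlgWinding.inside x₀ x₁ y₀ y₁))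
      + (1 / 2) * ((AlgWinding.zerosIn φ (AlgWinding.edges x₀ x₁ y₀ y₁) : ℚ)
        - AlgWinding.polesIn φ (AlgWinding.edges x₀ x₁ y₀ y₁))
      + (1 / 4) * ((AlgWinding.zerosIn φ (AlgWinding.vertices x₀ x₁ y₀ y₁) : ℚ)
        - AlgWinding.polesIn φ (AlgWinding.vertices x₀ x₁ y₀ y₁)) := by
  have hD : φ.denom ≠ 0 := RatFunc.denom_ne_zero φ
  have hN : φ.num ≠ 0 := RatFunc.num_ne_zero hφ
  have hcross : F * φ.denom = φ.num * G := by
    apply RatFunc.algebraMap_injective (AlgWinding.Cplx R)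
    rw [map_mul, map_mul]
    have hG' := RatFunc.algebraMap_ne_zero hG
    have hD' := RatFunc.algebraMap_ne_zero hD
    rw [← div_eq_div_iff hG' hD', RatFunc.num_div_denom, hFG]
  have hincl : AlgWinding.incl F * AlgWinding.incl φ.denom =
      AlgWinding.incl φ.num * AlgWinding.incl G := by
    have := congrArg AlgWinding.incl hcross
    simpa [AlgWinding.incl] using this
  have hlN := AlgWinding.nonzeroOnLines_incl hN
  have hlD := AlgWinding.nonzeroOnLines_incl hD
  have hlG := AlgWinding.nonzeroOnLines_incl hG
  have hlD' : AlgWinding.NonzeroOnLines (AlgWinding.conjPoly (AlgWinding.incl φ.denom)) :=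
    ⟨fun y => AlgWinding.restrict_conjPoly_ne_zero (hlD.1 y),
      fun x => AlgWinding.restrict_conjPoly_ne_zero (hlD.2 x)⟩
  have hev := fun z hz => AlgWinding.even_rootMultiplicity_of_even_ratVal (heven z hz)
  -- `F` and `G` may share factors of odd multiplicity at the vertices, so they are first traded for
  -- `φ.num` and `φ.denom`. The factors $D\overline D$ and $G\overline G$ are real and leave $w$
  -- unchanged.
  have hprod : AlgWinding.incl φ.denom * AlgWinding.conjPoly (AlgWinding.incl φ.denom) *
      (AlgWinding.incl F * AlgWinding.conjPoly (AlgWinding.incl G)) =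
      AlgWinding.incl G * AlgWinding.conjPoly (AlgWinding.incl G) *
      (AlgWinding.incl φ.num * AlgWinding.conjPoly (AlgWinding.incl φ.denom)) := by
    linear_combination (AlgWinding.conjPoly (AlgWinding.incl φ.denom) *
      AlgWinding.conjPoly (AlgWinding.incl G)) * hincl
  rw [AlgWinding.windingFrac, ← AlgWinding.winding_mul_conjPoly_mul hx hy hlD, hprod,
    AlgWinding.winding_mul_conjPoly_mul hx hy hlG, AlgWinding.winding_mul hx hy hlN hlD'
      (fun z hz => (AlgWinding.sameDirection_incl hN (hev z hz).1).cornersAgree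
        ((AlgWinding.sameDirection_incl hD (hev z hz).2).conjPoly hlD)),
    AlgWinding.winding_conjPoly hx hy, AlgWinding.winding_incl hx hy hN fun z hz => (hev z hz).1,
    AlgWinding.winding_incl hx hy hD fun z hz => (hev z hz).2,
    AlgWinding.sum_map_roots_weight, AlgWinding.sum_map_roots_weight]
  simp only [AlgWinding.zerosIn_eq, AlgWinding.polesIn_eq]
  ring
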